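/- Let $n\in\mathbb N$ and let $h:[0,\infty)\to\mathbb R$ be continuous and bounded below. Let $W:\mathbb R^{n\times n}\to\mathbb R$ be the (objective and isotropic) function of Valanis--Landel form $$W(F)=\sum_{k=1}^n h(\lambda_k)$$ for all $F\in\mathbb R^{n\times n}$ with singular values $\lambda_1,\dots,\lambda_n\ge 0$ (counted with multiplicity). Let $\tilde h:\mathbb R\to\mathbb R$, $\tilde h(t)=h(|t|)$, be the even extension of $h$, and let $C\tilde h:\mathbb R\to\mathbb R$ be its convex envelope. Then $$RW(F)=QW(F)=PW(F)=CW(F)=\sum_{k=1}^n C\tilde h(\lambda_k)$$ for all $F\in\mathbb R^{n\times n}$ with singular values $\lambda_1,\dots,\lambda_n$. Here the rank-one convex envelope $RW$, the quasiconvex envelope $QW$, the polyconvex envelope $PW$ and the convex envelope $CW$ are the pointwise suprema of all functions $w:\mathbb R^{n\times n}\to\mathbb R\cup\{+\infty\}$ with $w\le W$ that are, respectively, rank-one convex, quasiconvex, polyconvex and convex; $C\tilde h$ is likewise the pointwise supremum of all convex functions $w:\mathbb R\to\mathbb R\cup\{+\infty\}$ with $w\le\tilde h$. A function $w:\mathbb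 R^{n\times n}\to\mathbb R\cup\{+\infty\}$ is *rank-one convex* if $w((1-t)F_1+tF_2)\le(1-t)w(F_1)+t\,w(F_2)$ for all $t\in[0,1]$ and all $F_1,F_2$ with $\operatorname{rank}(F_2-F_1)=1$; it is *quasiconvex* if $\int_\Omega w(F+\nabla\vartheta(x))\,dx\ge|\Omega|\,w(F)$ for every bounded open $\Omega\subset\mathbb R^n$ with $|\partial\Omega|=0$, every $F\in\mathbb R^{n\times n}$ and every $\vartheta\in W^{1,\infty}_0(\Omega;\mathbb R^n)$ for which the integral exists, where $W_0^{1,\infty}=W^{1,\infty}\cap W_0^{1,1}$; it is *polyconvex* if $w(F)=P(M(F))$ for a convex function $P$ with values in $\mathbb R\cup\{+\infty\}$, where $M(F)$ is the vector of all minors of $F$ of orders $1,\dots,n$. -/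

import Mathlib

open MeasureTheory Filter Topology
open scoped ENNReal ContDiff

noncomputable section

/-- Convexity of a function with values in `ℝ ∪ {+∞}` (extended reals other than `⊥`). -/
def IsConvexFun {V : Type*} [AddCommGroup V] [Module ℝ V] (w : V → EReal) : Prop :=
  (∀ x, w x ≠ ⊥) ∧
    ∀ x y : V, ∀ t : ℝ, 0 ≤ t → t ≤ 1 →
      w ((1 - t) • x + t • y) ≤ ((1 - t : ℝ) : EReal) * w x + (t : EReal) * w y

/-- Rank-one convexity of a function `ℝ^{n×n} → ℝ ∪ {+∞}`. -/
def IsRankOneConvex {n : ℕ} (w : Matrix (Fin n) (Fin n) ℝ → EReal) : Prop :=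
  (∀ F, w F ≠ ⊥) ∧
    ∀ F₁ F₂ : Matrix (Fin n) (Fin n) ℝ, (F₂ - F₁).rank = 1 →
      ∀ t : ℝ, 0 ≤ t → t ≤ 1 →
        w ((1 - t) • F₁ + t • F₂) ≤ ((1 - t : ℝ) : EReal) * w F₁ + (t : EReal) * w F₂

/-- The index set of all minors of an `n × n` matrix: a size `k + 1` with `k < n`, together with
an increasing choice of `k + 1` rows and an increasing choice of `k + 1` columns. -/
abbrev MinorIndex (n : ℕ) : Type :=
  Σ k : Fin n, (Fin (k.val + 1) ↪o Fin n) × (Fin (k.val + 1) ↪o Fin n)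

/-- The vector of all minors (of all orders `1, …, n`) of a matrix. -/
def minors {n : ℕ} (F : Matrix (Fin n) (Fin n) ℝ) : MinorIndex n → ℝ :=
  fun I => (F.submatrix I.2.1 I.2.2).det

/-- Polyconvexity: `w` is a convex function, with values in `ℝ ∪ {+∞}`, of the vector of all
minors. -/
def IsPolyconvex {n : ℕ} (w : Matrix (Fin n) (Fin n) ℝ → EReal) : Prop :=
  ∃ P : (MinorIndex n → ℝ) → EReal, IsConvexFun P ∧ ∀ F, w F = P (minors F)

/-- Smooth real functions with compact support contained in `Ω`. (The space `Fin n → ℝ` is `ℝⁿ`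
with its usual topology and Lebesgue measure.) -/
def IsTestFunction {n : ℕ} (Ω : Set (Fin n → ℝ)) (φ : (Fin n → ℝ) → ℝ) : Prop :=
  ContDiff ℝ ∞ φ ∧ HasCompactSupport φ ∧ tsupport φ ⊆ Ω

/-- The partial derivative `∂φ/∂x_j`. -/
def partialDeriv {n : ℕ} (j : Fin n) (φ : (Fin n → ℝ) → ℝ) (x : Fin n → ℝ) : ℝ :=
  fderiv ℝ φ x (Pi.single j 1)

/-- `u ∈ W^{1,p}(Ω)` with weak gradient `(g 1, …, g n)`. -/
def IsSobolevOne {n : ℕ} (p : ℝ≥0∞) (Ω : Set (Fin n → ℝ)) (u : (Fin n → ℝ) → ℝ)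
    (g : Fin n → (Fin n → ℝ) → ℝ) : Prop :=
  MemLp u p (volume.restrict Ω) ∧
    (∀ j, MemLp (g j) p (volume.restrict Ω)) ∧
    ∀ φ : (Fin n → ℝ) → ℝ, IsTestFunction Ω φ → ∀ j,
      ∫ x in Ω, u x * partialDeriv j φ x = - ∫ x in Ω, g j x * φ x

/-- `u ∈ W₀^{1,∞}(Ω) = W^{1,∞}(Ω) ∩ W₀^{1,1}(Ω)`, for bounded open `Ω`, with weak gradient
`(g 1, …, g n)`; here `W₀^{1,1}(Ω)` is the closure of the test functions in `W^{1,1}(Ω)`. -/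
def IsSobolevOneInftyZero {n : ℕ} (Ω : Set (Fin n → ℝ)) (u : (Fin n → ℝ) → ℝ)
    (g : Fin n → (Fin n → ℝ) → ℝ) : Prop :=
  IsSobolevOne ⊤ Ω u g ∧
    ∃ φ : ℕ → (Fin n → ℝ) → ℝ, (∀ m, IsTestFunction Ω (φ m)) ∧
      Tendsto (fun m => eLpNorm (fun x => φ m x - u x) 1 (volume.restrict Ω)) atTop (𝓝 0) ∧
      ∀ j, Tendsto (fun m => eLpNorm (fun x => partialDeriv j (φ m) x - g j x) 1
        (volume.restrict Ω)) atTop (𝓝 0)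

/-- The Lebesgue integral of an extended real function exists (possibly as `±∞`). -/
def ExtIntegralExists {X : Type*} [MeasurableSpace X] (μ : Measure X) (f : X → EReal) : Prop :=
  AEMeasurable f μ ∧ (∫⁻ x, (f x).toENNReal ∂μ ≠ ⊤ ∨ ∫⁻ x, (-f x).toENNReal ∂μ ≠ ⊤)

/-- The Lebesgue integral of an extended real function, `∫ f⁺ - ∫ f⁻`. -/
def extIntegral {X : Type*} [MeasurableSpace X] (μ : Measure X) (f : X → EReal) : EReal :=
  ((∫⁻ x, (f x).toENNReal ∂μ : ℝ≥0∞) : EReal) - ((∫⁻ x, (-f x).toENNReal ∂μ : ℝ≥0∞) : EReal)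

/-- Quasiconvexity of a function `ℝ^{n×n} → ℝ ∪ {+∞}`: for every bounded open `Ω ⊆ ℝⁿ` with
Lebesgue-null boundary, every `F` and every `ϑ ∈ W₀^{1,∞}(Ω; ℝⁿ)` (with weak gradient `G`) for
which the integral exists, `∫_Ω w(F + ∇ϑ) ≥ |Ω| w(F)`. -/
def IsQuasiconvex {n : ℕ} (w : Matrix (Fin n) (Fin n) ℝ → EReal) : Prop :=
  (∀ F, w F ≠ ⊥) ∧
    ∀ Ω : Set (Fin n → ℝ), IsOpen Ω → Bornology.IsBounded Ω → volume (frontier Ω) = 0 →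
      ∀ (F : Matrix (Fin n) (Fin n) ℝ) (ϑ : (Fin n → ℝ) → (Fin n → ℝ))
        (G : (Fin n → ℝ) → Matrix (Fin n) (Fin n) ℝ),
        (∀ i, IsSobolevOneInftyZero Ω (fun x => ϑ x i) (fun j x => G x i j)) →
        ExtIntegralExists (volume.restrict Ω) (fun x => w (F + G x)) →
        ((volume Ω : ℝ≥0∞) : EReal) * w F ≤
          extIntegral (volume.restrict Ω) (fun x => w (F + G x))

/-- The pointwise supremum of all minorants of `f` that have the property `P`. -/
def envelope {V : Type*} (P : (V → EReal) → Prop) (f : V → EReal) (x : V) : EReal :=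
  sSup {a : EReal | ∃ w : V → EReal, P w ∧ (∀ y, w y ≤ f y) ∧ a = w x}

/-- The convex envelope `Cf`. -/
def convexEnvelope {V : Type*} [AddCommGroup V] [Module ℝ V] (f : V → EReal) : V → EReal :=
  envelope IsConvexFun f

/-- The rank-one convex envelope `RW`. -/
def rankOneConvexEnvelope {n : ℕ} (W : Matrix (Fin n) (Fin n) ℝ → EReal) :
    Matrix (Fin n) (Fin n) ℝ → EReal :=
  envelope IsRankOneConvex W

/-- The quasiconvex envelope `QW`. -/
def quasiconvexEnvelope {n : ℕ} (W : Matrix (Fin n) (Fin n) ℝ → EReal) :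
    Matrix (Fin n) (Fin n) ℝ → EReal :=
  envelope IsQuasiconvex W

/-- The polyconvex envelope `PW`. -/
def polyconvexEnvelope {n : ℕ} (W : Matrix (Fin n) (Fin n) ℝ → EReal) :
    Matrix (Fin n) (Fin n) ℝ → EReal :=
  envelope IsPolyconvex W

/-- The `k`-th singular value of `F` (in decreasing order, with multiplicity). -/
def singularValue {n : ℕ} (F : Matrix (Fin n) (Fin n) ℝ) (k : Fin n) : ℝ :=
  (Matrix.toEuclideanLin F).singularValues k

/-- The even extension to `ℝ` of a function on `[0, ∞)`. -/
def evenExtension (h : ℝ → ℝ) (t : ℝ) : ℝ :=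
  if 0 ≤ t then h t else h (-t)

end

/-!
All four envelopes are equal to `S F = ∑ k, g (σ k)`, where `g` is the convex envelope of the even
extension of `h` and `σ k` are the singular values of `F`. As `h` is bounded below, `g` is a real
convex even function, and it dominates every convex minorant of the even extension
(`exists_real_convexEnvelope`).

*`S` is a competitor in each class.* If `U` and `V` are orthogonal, every diagonal entry of
`Uᵀ X V` is bounded by an average of the singular values of `X`, with the weights forming a doubly
stochastic matrix; since `g` is convex and even, the sum of `g` over the diagonal is at most the
sum over the singular values, with equality for the singular value decomposition of `X`
(`sum_diag_le_sum_singularValue`). So `S` is a maximum of convex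
functions, and it has a supporting affine function at every matrix. Convexity implies rank-one
convexity and polyconvexity at once. Quasiconvexity (`isQuasiconvex_sum_singularValue`) follows
from the supporting affine function, because the weak gradient of a function in `W₀^{1,∞}(Ω)` has
mean value zero.

*No competitor exceeds `S`.* A competitor is finite, as it lies below the finite function `W`. It
is convex along the lines `s ↦ F + s a ⊗ b`, for `b` a row of an orthogonal matrix. Hence
`x ↦ w (U diag(x) Vᵀ)` is separately convex; it lies below the sum of the even extension of `h`
over the coordinates, which can be replaced by `g` one coordinate at a time
(`le_sum_convex_of_le_sum_singularValue`).

The convexity along lines is immediate for rank-one convex functions, and for polyconvex ones it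
holds because minors are affine along rank-one lines. A finite quasiconvex function need not be
known to be measurable in advance, so it is tested with fields whose gradient takes finitely many
values (`IsQuasiconvex.le_rankOne`): `a` times the minimum of a tent of width one in direction `b`
and of pyramid sides `R ± b' · x` in the directions `b'` orthogonal to `b`. As `R → ∞`, the
pyramid sides are active on a negligible fraction of the domain, and the volume fractions of the
two slopes of the tent are determined by the vanishing mean value of the gradient. The minimum `u`
of affine functions that is used here belongs to `W₀^{1,∞}({u > 0})` as the limit of cut-off
log-sum-exp approximations (`isSobolevOneInftyZero_min`).
-/

/-! ### Singular value decomposition -/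

lemma orthonormalBasis_matrix_mem_orthogonalGroup {n : ℕ}
    (b : OrthonormalBasis (Fin n) ℝ (EuclideanSpace ℝ (Fin n))) :
    (Matrix.of fun i k => b k i) ∈ Matrix.orthogonalGroup (Fin n) ℝ := by
  rw [Matrix.mem_orthogonalGroup_iff']
  ext i j
  have h := orthonormal_iff_ite.mp b.orthonormal i j
  rw [EuclideanSpace.inner_eq_star_dotProduct] at h
  simp only [Matrix.mul_apply, Matrix.one_apply, Matrix.of_apply, Matrix.transpose_apply, ← h,
    dotProduct, Pi.star_apply, star_trivial]
  exact Finset.sum_congr rfl fun k _ => mul_comm _ _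

/-- Every real square matrix has a singular value decomposition, with the singular values listed
in the order of `singularValue`. The left singular vectors with nonzero singular value are the
normalized images of the right ones; they are completed to an orthonormal basis. -/
theorem exists_singularValueDecomposition {n : ℕ} (F : Matrix (Fin n) (Fin n) ℝ) :
    ∃ U ∈ Matrix.orthogonalGroup (Fin n) ℝ, ∃ V ∈ Matrix.orthogonalGroup (Fin n) ℝ,
      F = U * Matrix.diagonal (singularValue F) * V.transpose := by
  set T := Matrix.toEuclideanLin F with hT
  have hn : Module.finrank ℝ (EuclideanSpace ℝ (Fin n)) = n := by simp
  have hs := T.isSymmetric_adjoint_comp_self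
  set v := hs.eigenvectorBasis hn with hv
  have hsq : ∀ i : Fin n, hs.eigenvalues hn i = singularValue F i ^ 2 :=
    fun i => (T.sq_singularValues_fin hn i).symm
  have hinner : ∀ i j : Fin n, inner ℝ (T (v i)) (T (v j)) =
      if i = j then singularValue F i ^ 2 else 0 := by
    intro i j
    rw [← LinearMap.adjoint_inner_left]
    have h := hs.apply_eigenvectorBasis hn i
    rw [LinearMap.comp_apply] at h
    rw [← hv] at h
    rw [h, inner_smul_left, orthonormal_iff_ite.mp v.orthonormal i j, hsq]
    simp
  obtain ⟨b, hb⟩ := Orthonormal.exists_orthonormalBasis_extension_of_card_eq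
    (𝕜 := ℝ) (E := EuclideanSpace ℝ (Fin n)) (ι := Fin n) (by simp)
    (v := fun i => (singularValue F i)⁻¹ • T (v i)) (s := {i | singularValue F i ≠ 0}) (by
      rw [orthonormal_iff_ite]
      rintro ⟨i, hi⟩ ⟨j, hj⟩
      simp only [Set.domRestrict_apply, inner_smul_left, inner_smul_right, hinner,
        Subtype.mk.injEq]
      have hi' : singularValue F i ≠ 0 := hi
      split_ifs with hij
      · subst hij
        simp
        field_simp
      · simp)
  have hTv : ∀ i, T (v i) = singularValue F i • b i := by
    intro i
    by_cases hi : singularValue F i = 0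
    · have h := hinner i i
      rw [if_pos rfl, hi] at h
      rw [hi, zero_smul]
      simpa using h
    · rw [hb i hi, smul_smul, mul_inv_cancel₀ hi, one_smul]
  refine ⟨_, orthonormalBasis_matrix_mem_orthogonalGroup b, _,
    orthonormalBasis_matrix_mem_orthogonalGroup v, ?_⟩
  have hV := (Matrix.mem_orthogonalGroup_iff (Fin n) ℝ).mp
    (orthonormalBasis_matrix_mem_orthogonalGroup v)
  have key : F * (Matrix.of fun i k => v k i) =
      (Matrix.of fun i k => b k i) * Matrix.diagonal (singularValue F) := by
    ext i k
    rw [Matrix.mul_diagonal]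
    have h := congrArg (fun x : EuclideanSpace ℝ (Fin n) => x i) (hTv k)
    simp only [hT, Matrix.toLpLin_apply, PiLp.smul_apply, smul_eq_mul] at h
    rw [Matrix.of_apply, mul_comm, ← h]
    rfl
  rw [← key, Matrix.mul_assoc, hV, Matrix.mul_one]

lemma singularValue_nonneg {n : ℕ} (F : Matrix (Fin n) (Fin n) ℝ) (k : Fin n) :
    0 ≤ singularValue F k :=
  LinearMap.singularValues_nonneg _ _

lemma charpoly_transpose_mul_self_of_orthogonal {n : ℕ} {U V : Matrix (Fin n) (Fin n) ℝ}
    (hU : U ∈ Matrix.orthogonalGroup (Fin n) ℝ) (hV : V ∈ Matrix.orthogonalGroup (Fin n) ℝ)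
    (x : Fin n → ℝ) :
    ((U * Matrix.diagonal x * V.transpose).transpose *
      (U * Matrix.diagonal x * V.transpose)).charpoly =
      ∏ i, (Polynomial.X - Polynomial.C (x i ^ 2)) := by
  have hU' : U.transpose * U = 1 := (Matrix.mem_orthogonalGroup_iff' (Fin n) ℝ).mp hU
  have hV' : V.transpose * V = 1 := (Matrix.mem_orthogonalGroup_iff' (Fin n) ℝ).mp hV
  have h : (U * Matrix.diagonal x * V.transpose).transpose *
      (U * Matrix.diagonal x * V.transpose) =
      V * (Matrix.diagonal (fun i => x i ^ 2) * V.transpose) := by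
    simp only [Matrix.transpose_mul, Matrix.transpose_transpose, Matrix.diagonal_transpose]
    calc V * (Matrix.diagonal x * U.transpose) * (U * Matrix.diagonal x * V.transpose)
        = V * (Matrix.diagonal x * (U.transpose * U) * Matrix.diagonal x * V.transpose) := by
          simp only [Matrix.mul_assoc]
      _ = _ := by rw [hU', Matrix.mul_one, Matrix.diagonal_mul_diagonal]; simp only [pow_two]
  rw [h, Matrix.charpoly_mul_comm, Matrix.mul_assoc, hV', Matrix.mul_one,
    Matrix.charpoly_diagonal]

/-- The singular values of `U diag(x) Vᵀ`, with `U` and `V` orthogonal, are the `|x k|` up to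
order: both families of squares are the roots of the same characteristic polynomial. -/
theorem sum_singularValue_of_orthogonal {n : ℕ} {U V : Matrix (Fin n) (Fin n) ℝ}
    (hU : U ∈ Matrix.orthogonalGroup (Fin n) ℝ) (hV : V ∈ Matrix.orthogonalGroup (Fin n) ℝ)
    (x : Fin n → ℝ) (f : ℝ → ℝ) :
    ∑ k, f (singularValue (U * Matrix.diagonal x * V.transpose) k) = ∑ k, f |x k| := by
  set X := U * Matrix.diagonal x * V.transpose with hX
  obtain ⟨U', hU', V', hV', hF⟩ := exists_singularValueDecomposition X
  have h1 := charpoly_transpose_mul_self_of_orthogonal hU hV x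
  have h2 := charpoly_transpose_mul_self_of_orthogonal hU' hV' (singularValue X)
  rw [← hX] at h1
  rw [← hF, h1] at h2
  have hroots : ∀ y : Fin n → ℝ, (∏ i, (Polynomial.X - Polynomial.C (y i))).roots =
      Finset.univ.val.map y := by
    intro y
    have := Polynomial.roots_multiset_prod_X_sub_C ((Finset.univ : Finset (Fin n)).val.map y)
    rwa [Multiset.map_map] at this
  have h3 := congrArg (fun p => (p.roots.map fun r => f (√r)).sum) h2
  simp only [hroots (fun i => x i ^ 2), hroots (fun i => singularValue X i ^ 2),
    Multiset.map_map, Function.comp_def, Real.sqrt_sq_eq_abs] at h3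
  have h4 : ∀ k, |singularValue X k| = singularValue X k :=
    fun k => abs_of_nonneg (singularValue_nonneg X k)
  simp only [h4] at h3
  exact h3.symm

/-! ### Convexity of sums over singular values -/

lemma ConvexOn.le_of_even_of_abs_le {g : ℝ → ℝ} (hg : ConvexOn ℝ Set.univ g)
    (heven : ∀ t, g (-t) = g t) {a b : ℝ} (hab : |a| ≤ b) : g a ≤ g b := by
  have h := hg.le_max_of_mem_Icc (Set.mem_univ (-b)) (Set.mem_univ b)
    (z := a) ⟨(abs_le.mp hab).1, (abs_le.mp hab).2⟩
  simpa [heven] using h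

lemma sum_sq_row_of_orthogonal {n : ℕ} {P : Matrix (Fin n) (Fin n) ℝ}
    (hP : P ∈ Matrix.orthogonalGroup (Fin n) ℝ) (k : Fin n) : ∑ m, P k m ^ 2 = 1 := by
  have h := congrFun (congrFun ((Matrix.mem_orthogonalGroup_iff (Fin n) ℝ).mp hP) k) k
  simpa [Matrix.mul_apply, pow_two] using h

lemma transpose_mem_orthogonalGroup {n : ℕ} {P : Matrix (Fin n) (Fin n) ℝ}
    (hP : P ∈ Matrix.orthogonalGroup (Fin n) ℝ) :
    P.transpose ∈ Matrix.orthogonalGroup (Fin n) ℝ := by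
  rw [Matrix.mem_orthogonalGroup_iff, Matrix.transpose_transpose]
  exact (Matrix.mem_orthogonalGroup_iff' (Fin n) ℝ).mp hP

/-- For `g` convex and even, the sum of `g` over the diagonal of `Uᵀ X V` is at most the sum over
the singular values of `X`: a diagonal entry is bounded by an average of the singular values, and
the matrix of the weights `(P k m ^ 2 + Q k m ^ 2) / 2` is doubly stochastic. -/
theorem sum_diag_le_sum_singularValue {n : ℕ} {g : ℝ → ℝ} (hg : ConvexOn ℝ Set.univ g)
    (heven : ∀ t, g (-t) = g t) {U V : Matrix (Fin n) (Fin n) ℝ}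
    (hU : U ∈ Matrix.orthogonalGroup (Fin n) ℝ) (hV : V ∈ Matrix.orthogonalGroup (Fin n) ℝ)
    (X : Matrix (Fin n) (Fin n) ℝ) :
    ∑ k, g ((U.transpose * X * V) k k) ≤ ∑ k, g (singularValue X k) := by
  obtain ⟨U', hU', V', hV', hX⟩ := exists_singularValueDecomposition X
  set σ := singularValue X with hσ
  have hσ0 : ∀ k, 0 ≤ σ k := singularValue_nonneg X
  have hP := mul_mem (transpose_mem_orthogonalGroup hU) hU'
  have hQ := mul_mem (transpose_mem_orthogonalGroup hV) hV'
  set P := U.transpose * U' with hPdef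
  set Q := V.transpose * V' with hQdef
  have hd : ∀ k, (U.transpose * X * V) k k = ∑ m, P k m * σ m * Q k m := by
    intro k
    have : U.transpose * X * V = P * Matrix.diagonal σ * Q.transpose := by
      rw [hX, hPdef, hQdef]
      simp only [Matrix.transpose_mul, Matrix.transpose_transpose, Matrix.mul_assoc]
    rw [this, Matrix.mul_apply]
    simp [Matrix.mul_diagonal]
  have hbound : ∀ k, g ((U.transpose * X * V) k k) ≤
      ∑ m, ((P k m ^ 2 + Q k m ^ 2) / 2) * g (σ m) := by
    intro k
    have h1 : |(U.transpose * X * V) k k| ≤ ∑ m, ((P k m ^ 2 + Q k m ^ 2) / 2) • σ m := by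
      rw [hd]
      refine (Finset.abs_sum_le_sum_abs _ _).trans (Finset.sum_le_sum fun m _ => ?_)
      have e : P k m * σ m * Q k m = (P k m * Q k m) * σ m := by ring
      rw [e, abs_mul, abs_of_nonneg (hσ0 m), smul_eq_mul]
      refine mul_le_mul_of_nonneg_right ?_ (hσ0 m)
      rw [abs_le]
      constructor <;> nlinarith [sq_nonneg (P k m + Q k m), sq_nonneg (P k m - Q k m)]
    refine (hg.le_of_even_of_abs_le heven h1).trans ?_
    refine hg.map_sum_le (fun m _ => by positivity) ?_ (fun _ _ => Set.mem_univ _)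
    rw [← Finset.sum_div, Finset.sum_add_distrib, sum_sq_row_of_orthogonal hP,
      sum_sq_row_of_orthogonal hQ]
    norm_num
  refine (Finset.sum_le_sum fun k _ => hbound k).trans ?_
  rw [Finset.sum_comm]
  refine (Finset.sum_congr rfl fun m _ => ?_).le
  rw [← Finset.sum_mul, ← Finset.sum_div, Finset.sum_add_distrib]
  have h1 := sum_sq_row_of_orthogonal (transpose_mem_orthogonalGroup hP) m
  have h2 := sum_sq_row_of_orthogonal (transpose_mem_orthogonalGroup hQ) m
  simp only [Matrix.transpose_apply] at h1 h2
  rw [h1, h2]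
  norm_num

lemma diag_of_singularValueDecomposition {n : ℕ} {U V X : Matrix (Fin n) (Fin n) ℝ}
    {x : Fin n → ℝ}
    (hU : U ∈ Matrix.orthogonalGroup (Fin n) ℝ) (hV : V ∈ Matrix.orthogonalGroup (Fin n) ℝ)
    (hX : X = U * Matrix.diagonal x * V.transpose) (k : Fin n) :
    (U.transpose * X * V) k k = x k := by
  have hU' : U.transpose * U = 1 := (Matrix.mem_orthogonalGroup_iff' (Fin n) ℝ).mp hU
  have hV' : V.transpose * V = 1 := (Matrix.mem_orthogonalGroup_iff' (Fin n) ℝ).mp hV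
  have : U.transpose * X * V = (U.transpose * U) * Matrix.diagonal x * (V.transpose * V) := by
    rw [hX]; simp only [Matrix.mul_assoc]
  rw [this, hU', hV', Matrix.mul_one, Matrix.one_mul, Matrix.diagonal_apply_eq]

/-- Sums of a convex even function over the singular values are convex functions of the matrix:
they are maxima over orthogonal `U`, `V` of the convex functions
`X ↦ ∑ k, g ((Uᵀ X V) k k)`. -/
theorem convex_sum_singularValue {n : ℕ} {g : ℝ → ℝ} (hg : ConvexOn ℝ Set.univ g)
    (heven : ∀ t, g (-t) = g t) (X Y : Matrix (Fin n) (Fin n) ℝ) {t : ℝ} (h0 : 0 ≤ t)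
    (h1 : t ≤ 1) :
    ∑ k, g (singularValue ((1 - t) • X + t • Y) k) ≤
      (1 - t) * ∑ k, g (singularValue X k) + t * ∑ k, g (singularValue Y k) := by
  obtain ⟨U, hU, V, hV, hZ⟩ := exists_singularValueDecomposition ((1 - t) • X + t • Y)
  have hle := add_le_add
    (mul_le_mul_of_nonneg_left (sum_diag_le_sum_singularValue hg heven hU hV X)
      (sub_nonneg.mpr h1))
    (mul_le_mul_of_nonneg_left (sum_diag_le_sum_singularValue hg heven hU hV Y) h0)
  refine le_trans ?_ hle
  rw [Finset.mul_sum, Finset.mul_sum, ← Finset.sum_add_distrib]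
  refine Finset.sum_le_sum fun k _ => ?_
  rw [← diag_of_singularValueDecomposition hU hV hZ k]
  have e : (U.transpose * ((1 - t) • X + t • Y) * V) k k =
      (1 - t) • (U.transpose * X * V) k k + t • (U.transpose * Y * V) k k := by
    simp [Matrix.mul_add, Matrix.add_mul]
  rw [e]
  exact hg.2 (Set.mem_univ _) (Set.mem_univ _) (sub_nonneg.mpr h1) h0 (by ring)

lemma ConvexOn.exists_affine_le {g : ℝ → ℝ} (hg : ConvexOn ℝ Set.univ g) (x : ℝ) :
    ∃ c : ℝ, ∀ y, g x + c * (y - x) ≤ g y := by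
  have hx : x ∈ interior (Set.univ : Set ℝ) := by simp
  refine ⟨derivWithin g (Set.Ioi x) x, fun y => ?_⟩
  rcases lt_trichotomy x y with h | rfl | h
  · have := hg.rightDeriv_le_slope_of_mem_interior hx (Set.mem_univ y) h
    rw [slope_def_field, le_div_iff₀ (sub_pos.mpr h)] at this
    linarith
  · simp
  · have h1 := hg.slope_le_leftDeriv_of_mem_interior (Set.mem_univ y) hx h
    have h2 := h1.trans (hg.leftDeriv_le_rightDeriv_of_mem_interior hx)
    rw [slope_def_field, div_le_iff₀ (sub_pos.mpr h)] at h2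
    linarith

/-- The subgradient inequality for a sum of a convex even function over the singular values. -/
theorem exists_affine_le_sum_singularValue {n : ℕ} {g : ℝ → ℝ} (hg : ConvexOn ℝ Set.univ g)
    (heven : ∀ t, g (-t) = g t) (F : Matrix (Fin n) (Fin n) ℝ) :
    ∃ C : Matrix (Fin n) (Fin n) ℝ, ∀ X, ∑ k, g (singularValue F k) + ∑ i, ∑ j, C i j * X i j ≤
      ∑ k, g (singularValue (F + X) k) := by
  obtain ⟨U, hU, V, hV, hF⟩ := exists_singularValueDecomposition F
  choose c hc using fun k => hg.exists_affine_le (singularValue F k)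
  refine ⟨fun i j => ∑ k, c k * (U i k * V j k), fun X => ?_⟩
  refine le_trans ?_ (sum_diag_le_sum_singularValue hg heven hU hV (F + X))
  have e : ∑ i, ∑ j, (∑ k, c k * (U i k * V j k)) * X i j =
      ∑ k, c k * (U.transpose * X * V) k k := by
    simp only [Matrix.mul_apply, Matrix.transpose_apply, Finset.sum_mul, Finset.mul_sum]
    rw [Finset.sum_congr rfl fun i _ => Finset.sum_comm, Finset.sum_comm]
    refine Finset.sum_congr rfl fun k _ => ?_
    rw [Finset.sum_comm]
    refine Finset.sum_congr rfl fun i _ => Finset.sum_congr rfl fun j _ => by ring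
  rw [e, ← Finset.sum_add_distrib]
  refine Finset.sum_le_sum fun k _ => ?_
  refine le_trans (le_of_eq ?_) (hc k _)
  rw [Matrix.mul_add, Matrix.add_mul, Matrix.add_apply,
    diag_of_singularValueDecomposition hU hV hF]
  ring

/-! ### The extended Lebesgue integral -/

lemma toENNReal_neg_coe (r : ℝ) : (-(r : EReal)).toENNReal = ENNReal.ofReal (-r) := by
  rw [← EReal.coe_neg, EReal.real_coe_toENNReal]

lemma extIntegral_coe {X : Type*} [MeasurableSpace X] {μ : Measure X} {f : X → ℝ}
    (hf : Integrable f μ) :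
    extIntegral μ (fun x => (f x : EReal)) = ((∫ x, f x ∂μ : ℝ) : EReal) := by
  have h1 : ∫⁻ x, ENNReal.ofReal (f x) ∂μ ≠ ⊤ := hf.lintegral_lt_top.ne
  have h2 : ∫⁻ x, ENNReal.ofReal (-f x) ∂μ ≠ ⊤ := hf.neg.lintegral_lt_top.ne
  rw [integral_eq_lintegral_pos_part_sub_lintegral_neg_part hf, EReal.coe_sub, extIntegral]
  simp only [EReal.real_coe_toENNReal, toENNReal_neg_coe]
  rw [EReal.coe_ennreal_toReal h1, EReal.coe_ennreal_toReal h2]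

lemma extIntegralExists_coe {X : Type*} [MeasurableSpace X] {μ : Measure X} {f : X → ℝ}
    (hf : Integrable f μ) : ExtIntegralExists μ (fun x => (f x : EReal)) := by
  refine ⟨measurable_coe_real_ereal.comp_aemeasurable hf.aemeasurable, Or.inl ?_⟩
  simp only [EReal.real_coe_toENNReal]
  exact hf.lintegral_lt_top.ne

lemma extIntegral_mono {X : Type*} [MeasurableSpace X] {μ : Measure X} {f g : X → EReal}
    (h : ∀ x, f x ≤ g x) : extIntegral μ f ≤ extIntegral μ g := by
  refine EReal.sub_le_sub ?_ ?_ <;> rw [EReal.coe_ennreal_le_coe_ennreal_iff] <;>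
    refine lintegral_mono fun x => EReal.toENNReal_le_toENNReal ?_
  · exact h x
  · exact EReal.neg_le_neg_iff.mpr (h x)

/-! ### Sobolev functions with zero boundary values -/

lemma IsTestFunction.continuous_partialDeriv {n : ℕ} {Ω : Set (Fin n → ℝ)}
    {φ : (Fin n → ℝ) → ℝ} (h : IsTestFunction Ω φ) (j : Fin n) :
    Continuous (partialDeriv j φ) :=
  (h.1.continuous_fderiv (by simp)).clm_apply continuous_const

lemma IsTestFunction.hasCompactSupport_partialDeriv {n : ℕ} {Ω : Set (Fin n → ℝ)}
    {φ : (Fin n → ℝ) → ℝ} (h : IsTestFunction Ω φ) (j : Fin n) :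
    HasCompactSupport (partialDeriv j φ) :=
  h.2.1.fderiv_apply (𝕜 := ℝ) _

lemma IsTestFunction.eq_zero_of_notMem {n : ℕ} {Ω : Set (Fin n → ℝ)}
    {φ : (Fin n → ℝ) → ℝ} (h : IsTestFunction Ω φ) {x : Fin n → ℝ} (hx : x ∉ Ω) : φ x = 0 :=
  image_eq_zero_of_notMem_tsupport fun hx' => hx (h.2.2 hx')

lemma IsTestFunction.partialDeriv_eq_zero_of_notMem {n : ℕ} {Ω : Set (Fin n → ℝ)}
    {φ : (Fin n → ℝ) → ℝ} (h : IsTestFunction Ω φ) (j : Fin n) {x : Fin n → ℝ} (hx : x ∉ Ω) :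
    partialDeriv j φ x = 0 := by
  have : fderiv ℝ φ x = 0 :=
    image_eq_zero_of_notMem_tsupport fun hx' => hx (h.2.2 (tsupport_fderiv_subset ℝ hx'))
  rw [partialDeriv, this]; rfl

lemma IsTestFunction.integral_partialDeriv {n : ℕ} {Ω : Set (Fin n → ℝ)}
    {φ : (Fin n → ℝ) → ℝ} (h : IsTestFunction Ω φ) (j : Fin n) :
    ∫ x in Ω, partialDeriv j φ x = 0 := by
  rw [setIntegral_eq_integral_of_forall_compl_eq_zero
    fun x hx => h.partialDeriv_eq_zero_of_notMem j hx]
  have hi := (h.continuous_partialDeriv j).integrable_of_hasCompactSupport (μ := volume)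
    (h.hasCompactSupport_partialDeriv j)
  have hφ := h.1.continuous.integrable_of_hasCompactSupport (μ := volume) h.2.1
  have := integral_mul_fderiv_eq_neg_fderiv_mul_of_integrable (μ := volume)
    (f := fun _ : Fin n → ℝ => (1 : ℝ)) (g := φ) (v := Pi.single j 1) (by simp)
    (by simp only [one_mul]; exact hi) (by simpa using hφ)
    (fun x _ => differentiableAt_const _)
    (fun x _ => (h.1.differentiable (by simp)) x)
  simpa [partialDeriv] using this

lemma IsTestFunction.integral_mul_partialDeriv {n : ℕ} {Ω : Set (Fin n → ℝ)}
    {φ ψ : (Fin n → ℝ) → ℝ} (hφ : IsTestFunction Ω φ) (hψ : IsTestFunction Ω ψ) (j : Fin n) :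
    ∫ x in Ω, φ x * partialDeriv j ψ x = - ∫ x in Ω, partialDeriv j φ x * ψ x := by
  rw [setIntegral_eq_integral_of_forall_compl_eq_zero
      fun x hx => by rw [hφ.eq_zero_of_notMem hx, zero_mul],
    setIntegral_eq_integral_of_forall_compl_eq_zero
      fun x hx => by rw [hψ.eq_zero_of_notMem hx, mul_zero]]
  have h1 := hφ.continuous_partialDeriv j
  have h2 := hψ.continuous_partialDeriv j
  have h3 := hφ.1.continuous
  have h4 := hψ.1.continuous
  exact integral_mul_fderiv_eq_neg_fderiv_mul_of_integrable (μ := volume)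
    ((h1.mul h4).integrable_of_hasCompactSupport hψ.2.1.mul_left)
    ((h3.mul h2).integrable_of_hasCompactSupport hφ.2.1.mul_right)
    ((h3.mul h4).integrable_of_hasCompactSupport hψ.2.1.mul_left)
    (fun x _ => (hφ.1.differentiable (by simp)) x)
    (fun x _ => (hψ.1.differentiable (by simp)) x)

/-- The weak gradient of a function in `W₀^{1,∞}(Ω)` has mean value zero. -/
theorem IsSobolevOneInftyZero.integral_eq_zero {n : ℕ} {Ω : Set (Fin n → ℝ)}
    {u : (Fin n → ℝ) → ℝ} {g : Fin n → (Fin n → ℝ) → ℝ}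
    (h : IsSobolevOneInftyZero Ω u g) (j : Fin n) :
    ∫ x in Ω, g j x = 0 := by
  obtain ⟨⟨-, hg, -⟩, φ, hφ, -, hlim⟩ := h
  have h1 := tendsto_integral_of_L1 (μ := volume.restrict Ω) (g j) (hg j).1
    (F := fun m x => partialDeriv j (φ m) x) (l := atTop)
    (Eventually.of_forall fun m =>
      (((hφ m).continuous_partialDeriv j).integrable_of_hasCompactSupport
        ((hφ m).hasCompactSupport_partialDeriv j)).integrableOn)
    (by simpa only [eLpNorm_one_eq_lintegral_enorm] using hlim j)
  simp only [(hφ _).integral_partialDeriv] at h1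
  exact tendsto_nhds_unique h1 tendsto_const_nhds

lemma tendsto_eLpNorm_one_of_bounded {X : Type*} [MeasurableSpace X] {μ : Measure X}
    [IsFiniteMeasure μ] {f : ℕ → X → ℝ} {g : X → ℝ} {C : ℝ}
    (hf : ∀ m, AEStronglyMeasurable (f m) μ) (hC : ∀ m, ∀ᵐ x ∂μ, ‖f m x‖ ≤ C)
    (hlim : ∀ᵐ x ∂μ, Tendsto (fun m => f m x) atTop (𝓝 (g x))) :
    Tendsto (fun m => eLpNorm (fun x => f m x - g x) 1 μ) atTop (𝓝 0) := by
  have := tendsto_lintegral_norm_of_dominated_convergence (bound := fun _ => C) hf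
    (integrable_const C).2 hC hlim
  simpa only [eLpNorm_one_eq_lintegral_enorm, ofReal_norm] using this

lemma memLp_top_of_tendsto_of_bounded {X : Type*} [MeasurableSpace X] {μ : Measure X}
    {f : ℕ → X → ℝ} {g : X → ℝ} {C : ℝ}
    (hf : ∀ m, AEStronglyMeasurable (f m) μ) (hC : ∀ m, ∀ᵐ x ∂μ, ‖f m x‖ ≤ C)
    (hlim : ∀ᵐ x ∂μ, Tendsto (fun m => f m x) atTop (𝓝 (g x))) : MemLp g ⊤ μ := by
  refine memLp_top_of_bound (aestronglyMeasurable_of_tendsto_ae atTop hf hlim) C ?_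
  filter_upwards [ae_all_iff.mpr hC, hlim] with x h1 h2
  exact le_of_tendsto h2.norm (Eventually.of_forall h1)

/-- A bounded almost everywhere limit of test functions whose partial derivatives also converge
boundedly almost everywhere lies in `W₀^{1,∞}(Ω)`. -/
theorem isSobolevOneInftyZero_of_tendsto {n : ℕ} {Ω : Set (Fin n → ℝ)} (hΩm : MeasurableSet Ω)
    (hΩ : volume Ω ≠ ⊤) {φ : ℕ → (Fin n → ℝ) → ℝ} {u : (Fin n → ℝ) → ℝ}
    {g : Fin n → (Fin n → ℝ) → ℝ} {C : ℝ}
    (hφ : ∀ m, IsTestFunction Ω (φ m)) (hC : ∀ m, ∀ x ∈ Ω, |φ m x| ≤ C)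
    (hC' : ∀ m j, ∀ x ∈ Ω, |partialDeriv j (φ m) x| ≤ C)
    (hu : ∀ᵐ x ∂volume.restrict Ω, Tendsto (fun m => φ m x) atTop (𝓝 (u x)))
    (hg : ∀ j, ∀ᵐ x ∂volume.restrict Ω,
      Tendsto (fun m => partialDeriv j (φ m) x) atTop (𝓝 (g j x))) :
    IsSobolevOneInftyZero Ω u g := by
  have : IsFiniteMeasure (volume.restrict Ω) := ⟨by simpa using hΩ.lt_top⟩
  have hm1 : ∀ m, AEStronglyMeasurable (φ m) (volume.restrict Ω) :=
    fun m => (hφ m).1.continuous.aestronglyMeasurable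
  have hm2 : ∀ j m, AEStronglyMeasurable (partialDeriv j (φ m)) (volume.restrict Ω) :=
    fun j m => ((hφ m).continuous_partialDeriv j).aestronglyMeasurable
  have hb1 : ∀ m, ∀ᵐ x ∂volume.restrict Ω, ‖φ m x‖ ≤ C :=
    fun m => (ae_restrict_iff' hΩm).mpr (Eventually.of_forall fun x hx => hC m x hx)
  have hb2 : ∀ j m, ∀ᵐ x ∂volume.restrict Ω, ‖partialDeriv j (φ m) x‖ ≤ C :=
    fun j m => (ae_restrict_iff' hΩm).mpr (Eventually.of_forall fun x hx => hC' m j x hx)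
  refine ⟨⟨memLp_top_of_tendsto_of_bounded hm1 hb1 hu,
    fun j => memLp_top_of_tendsto_of_bounded (hm2 j) (hb2 j) (hg j), fun ψ hψ j => ?_⟩,
    φ, hφ, tendsto_eLpNorm_one_of_bounded hm1 hb1 hu,
    fun j => tendsto_eLpNorm_one_of_bounded (hm2 j) (hb2 j) (hg j)⟩
  have hψ1 := hψ.1.continuous
  have hψ2 := hψ.continuous_partialDeriv j
  have lim1 : Tendsto (fun m => ∫ x in Ω, φ m x * partialDeriv j ψ x) atTop
      (𝓝 (∫ x in Ω, u x * partialDeriv j ψ x)) := by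
    refine tendsto_integral_of_dominated_convergence (fun x => C * ‖partialDeriv j ψ x‖)
      (fun m => (hm1 m).mul hψ2.aestronglyMeasurable) ?_ (fun m => ?_) ?_
    · exact ((hψ2.integrable_of_hasCompactSupport
        (hψ.hasCompactSupport_partialDeriv j)).norm.const_mul C).integrableOn
    · filter_upwards [hb1 m] with x hx
      rw [norm_mul]
      exact mul_le_mul_of_nonneg_right hx (norm_nonneg _)
    · filter_upwards [hu] with x hx using hx.mul_const _
  have lim2 : Tendsto (fun m => ∫ x in Ω, partialDeriv j (φ m) x * ψ x) atTop
      (𝓝 (∫ x in Ω, g j x * ψ x)) := by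
    refine tendsto_integral_of_dominated_convergence (fun x => C * ‖ψ x‖)
      (fun m => (hm2 j m).mul hψ1.aestronglyMeasurable) ?_ (fun m => ?_) ?_
    · exact ((hψ1.integrable_of_hasCompactSupport hψ.2.1).norm.const_mul C).integrableOn
    · filter_upwards [hb2 j m] with x hx
      rw [norm_mul]
      exact mul_le_mul_of_nonneg_right hx (norm_nonneg _)
    · filter_upwards [hg j] with x hx using hx.mul_const _
  simp only [(hφ _).integral_mul_partialDeriv hψ] at lim1
  exact tendsto_nhds_unique lim1 lim2.neg

/-! ### Minima of affine functions as Sobolev functions -/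

/-- A smooth function that vanishes on `(-∞, 1]` and is the identity on `[2, ∞)`. -/
noncomputable def smoothCutoff (y : ℝ) : ℝ := y * Real.smoothTransition (y - 1)

lemma contDiff_smoothCutoff : ContDiff ℝ ∞ smoothCutoff :=
  contDiff_id.mul (Real.smoothTransition.contDiff.comp (contDiff_id.sub contDiff_const))

lemma smoothCutoff_of_le_one {y : ℝ} (hy : y ≤ 1) : smoothCutoff y = 0 := by
  rw [smoothCutoff, Real.smoothTransition.zero_of_nonpos (by linarith), mul_zero]

lemma smoothCutoff_of_two_le {y : ℝ} (hy : 2 ≤ y) : smoothCutoff y = y := by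
  rw [smoothCutoff, Real.smoothTransition.one_of_one_le (by linarith), mul_one]

lemma abs_smoothCutoff_le (y : ℝ) : |smoothCutoff y| ≤ max y 0 := by
  rcases le_total y 1 with h | h
  · rw [smoothCutoff_of_le_one h, abs_zero]; exact le_max_right _ _
  · have h0 := Real.smoothTransition.nonneg (y - 1)
    have h1 := Real.smoothTransition.le_one (y - 1)
    refine le_max_of_le_left ?_
    rw [smoothCutoff, abs_of_nonneg (by positivity)]
    nlinarith

lemma deriv_smoothCutoff_of_two_lt {y : ℝ} (hy : 2 < y) : deriv smoothCutoff y = 1 := by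
  have : smoothCutoff =ᶠ[𝓝 y] id := by
    filter_upwards [Ioi_mem_nhds hy] with z hz using smoothCutoff_of_two_le (le_of_lt hz)
  rw [this.deriv_eq, deriv_id]

lemma deriv_smoothCutoff_of_lt_one {y : ℝ} (hy : y < 1) : deriv smoothCutoff y = 0 := by
  have : smoothCutoff =ᶠ[𝓝 y] fun _ => 0 := by
    filter_upwards [Iio_mem_nhds hy] with z hz using smoothCutoff_of_le_one (le_of_lt hz)
  rw [this.deriv_eq, deriv_const]

lemma exists_abs_deriv_smoothCutoff_le : ∃ C, ∀ y, |deriv smoothCutoff y| ≤ C := by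
  have hc : Continuous (deriv smoothCutoff) := contDiff_smoothCutoff.continuous_deriv (by simp)
  obtain ⟨C, hC⟩ := (isCompact_Icc (a := (1 : ℝ)) (b := 2)).exists_bound_of_continuousOn
    hc.continuousOn
  refine ⟨max C 1, fun y => ?_⟩
  rcases lt_or_ge y 1 with h | h
  · rw [deriv_smoothCutoff_of_lt_one h, abs_zero]; exact le_max_of_le_right zero_le_one
  rcases lt_or_ge 2 y with h' | h'
  · rw [deriv_smoothCutoff_of_two_lt h', abs_one]; exact le_max_right _ _
  · exact le_max_of_le_left (hC y ⟨h, h'⟩)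

/-- The members of a family of affine functions on `ℝⁿ`, with constants `c i` and gradients
`d i`. -/
def affineForm {n : ℕ} {ι : Type*} (c : ι → ℝ) (d : ι → Fin n → ℝ) (i : ι) (x : Fin n → ℝ) : ℝ :=
  c i + d i ⬝ᵥ x

/-- The open cell on which the `i`-th affine function is strictly smaller than all the others. -/
def minCell {n : ℕ} {ι : Type*} (c : ι → ℝ) (d : ι → Fin n → ℝ) (i : ι) : Set (Fin n → ℝ) :=
  {x | ∀ j, j ≠ i → affineForm c d i x < affineForm c d j x}

/-- The convex open set on which all the affine functions are positive. -/
def positivitySet {n : ℕ} {ι : Type*} (c : ι → ℝ) (d : ι → Fin n → ℝ) : Set (Fin n → ℝ) :=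
  {x | ∀ i, 0 < affineForm c d i x}

/-- The smooth approximation `-log (∑ i, exp (-m * α i))` of `m * min (α i)`. -/
noncomputable def negLogSumExp {n : ℕ} {ι : Type*} [Fintype ι] (c : ι → ℝ) (d : ι → Fin n → ℝ)
    (m : ℝ) (x : Fin n → ℝ) : ℝ :=
  -Real.log (∑ i, Real.exp (-m * affineForm c d i x))

section

variable {n : ℕ} {ι : Type*} (c : ι → ℝ) (d : ι → Fin n → ℝ)

lemma contDiff_affineForm (i : ι) : ContDiff ℝ ∞ (affineForm c d i) := by
  unfold affineForm dotProduct
  fun_prop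

lemma affineForm_add_smul (i : ι) (x v : Fin n → ℝ) (t : ℝ) :
    affineForm c d i (x + t • v) = affineForm c d i x + t * (d i ⬝ᵥ v) := by
  simp [affineForm, add_assoc]

lemma measurableSet_minCell [Finite ι] (i : ι) : MeasurableSet (minCell c d i) := by
  have : minCell c d i = ⋂ j, ⋂ (_ : j ≠ i), {x | affineForm c d i x < affineForm c d j x} := by
    ext; simp [minCell]
  rw [this]
  exact MeasurableSet.iInter fun j => MeasurableSet.iInter fun _ =>
    measurableSet_lt (contDiff_affineForm c d i).continuous.measurable
      (contDiff_affineForm c d j).continuous.measurable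

lemma isOpen_positivitySet [Finite ι] : IsOpen (positivitySet c d) := by
  have : positivitySet c d = ⋂ j, {x | 0 < affineForm c d j x} := by
    ext; simp [positivitySet]
  rw [this]
  exact isOpen_iInter_of_finite fun j =>
    isOpen_lt continuous_const (contDiff_affineForm c d j).continuous

lemma convex_positivitySet : Convex ℝ (positivitySet c d) := by
  intro x hx y hy a b ha hb hab i
  have e : affineForm c d i (a • x + b • y) = a * affineForm c d i x + b * affineForm c d i y := by
    simp only [affineForm, dotProduct_add, dotProduct_smul, smul_eq_mul]
    linear_combination -c i * hab
  rw [e]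
  rcases ha.eq_or_lt with rfl | ha'
  · have : b = 1 := by linarith
    subst this
    simpa using hy i
  · have h1 := mul_pos ha' (hx i)
    have h2 := mul_nonneg hb (hy i).le
    linarith

lemma sum_indicator_minCell [Fintype ι] {i : ι} {x : Fin n → ℝ} (hx : x ∈ minCell c d i)
    (f : ι → (Fin n → ℝ) → ℝ) : ∑ l, (minCell c d l).indicator (f l) x = f i x := by
  rw [Finset.sum_eq_single i, Set.indicator_of_mem hx]
  · intro l _ hl
    exact Set.indicator_of_notMem (fun (h : x ∈ minCell c d l) =>
      lt_asymm (hx l hl) (h i (Ne.symm hl))) _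
  · simp

lemma volume_hyperplane_eq_zero {e : Fin n → ℝ} (he : e ≠ 0) (b : ℝ) :
    volume {x : Fin n → ℝ | e ⬝ᵥ x = b} = 0 := by
  let s : AffineSubspace ℝ (Fin n → ℝ) :=
    { carrier := {x | e ⬝ᵥ x = b}
      smul_vsub_vadd_mem' := by
        intro t p₁ p₂ p₃ h₁ h₂ h₃
        simp only [Set.mem_ofPred_eq] at h₁ h₂ h₃ ⊢
        simp [dotProduct_add, dotProduct_smul, dotProduct_sub, h₁, h₂, h₃] }
  refine Measure.addHaar_affineSubspace volume s fun hs => he ?_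
  have hall : ∀ x, e ⬝ᵥ x = b := fun x => by
    have : x ∈ s := hs ▸ AffineSubspace.mem_top ℝ _ x
    exact this
  rw [← dotProduct_self_eq_zero, hall e, ← hall 0, dotProduct_zero]

lemma ae_exists_mem_minCell [Finite ι] [Nonempty ι] (hd : Function.Injective d) :
    ∀ᵐ x : Fin n → ℝ, ∃ i, x ∈ minCell c d i := by
  have h : ∀ i j, i ≠ j → ∀ᵐ x : Fin n → ℝ, affineForm c d i x ≠ affineForm c d j x := by
    intro i j hij
    have := volume_hyperplane_eq_zero (sub_ne_zero.mpr (hd.ne hij)) (c j - c i)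
    rw [ae_iff]
    refine measure_mono_null (fun x hx => ?_) this
    simp only [affineForm, not_not, Set.mem_ofPred_eq, sub_dotProduct] at hx ⊢
    linarith
  have h' : ∀ᵐ x : Fin n → ℝ, ∀ i j, i ≠ j → affineForm c d i x ≠ affineForm c d j x :=
    ae_all_iff.mpr fun i => ae_all_iff.mpr fun j => by
      by_cases hij : i = j
      · exact Eventually.of_forall fun x hx => absurd hij hx
      · filter_upwards [h i j hij] with x hx _ using hx
  filter_upwards [h'] with x hx
  obtain ⟨i, hi⟩ := Finite.exists_min fun i => affineForm c d i x
  exact ⟨i, fun j hj => lt_of_le_of_ne (hi j) (hx i j (Ne.symm hj))⟩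

variable [Fintype ι]

lemma negLogSumExp_le (m : ℝ) (x : Fin n → ℝ) (i : ι) :
    negLogSumExp c d m x ≤ m * affineForm c d i x := by
  have h : Real.exp (-m * affineForm c d i x) ≤ ∑ i, Real.exp (-m * affineForm c d i x) :=
    Finset.single_le_sum (f := fun i => Real.exp (-m * affineForm c d i x))
      (fun _ _ => (Real.exp_pos _).le) (Finset.mem_univ i)
  have := Real.log_le_log (Real.exp_pos _) h
  rw [Real.log_exp] at this
  rw [negLogSumExp]
  linarith

open Classical in
variable {c d} in
lemma tendsto_softmax {x : Fin n → ℝ} {i : ι} (hi : x ∈ minCell c d i) (l : ι) :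
    Tendsto (fun m => Real.exp (-m * affineForm c d l x) /
      (∑ k, Real.exp (-m * affineForm c d k x))) atTop (𝓝 (if l = i then 1 else 0)) := by
  have h1 : ∀ k, Tendsto (fun m => Real.exp (-m * (affineForm c d k x - affineForm c d i x)))
      atTop (𝓝 (if k = i then 1 else 0)) := by
    intro k
    split_ifs with hk
    · subst hk; simp
    · have hpos : 0 < affineForm c d k x - affineForm c d i x := sub_pos.mpr (hi k hk)
      have := Real.tendsto_exp_neg_atTop_nhds_zero.comp (tendsto_id.atTop_mul_const hpos)
      refine this.congr fun m => ?_
      simp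
  have h2 := (h1 l).div (tendsto_finsetSum Finset.univ fun k _ => h1 k) (by simp)
  simp only [Finset.sum_ite_eq', Finset.mem_univ, if_true, div_one] at h2
  refine h2.congr fun m => ?_
  have e : ∀ k, Real.exp (-m * (affineForm c d k x - affineForm c d i x)) =
      Real.exp (-m * affineForm c d k x) * Real.exp (m * affineForm c d i x) := fun k => by
    rw [← Real.exp_add]; ring_nf
  simp only [Pi.div_apply, e]
  rw [← Finset.sum_mul, mul_div_mul_right _ _ (Real.exp_pos _).ne']

variable [Nonempty ι]

lemma sum_exp_pos (m : ℝ) (x : Fin n → ℝ) :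
    0 < ∑ i, Real.exp (-m * affineForm c d i x) :=
  Finset.sum_pos (fun _ _ => Real.exp_pos _) Finset.univ_nonempty

lemma le_negLogSumExp {m y : ℝ} (hm : 0 ≤ m) {x : Fin n → ℝ}
    (hy : ∀ i, y ≤ affineForm c d i x) :
    m * y - Real.log (Fintype.card ι) ≤ negLogSumExp c d m x := by
  have h : ∑ i, Real.exp (-m * affineForm c d i x) ≤ Fintype.card ι * Real.exp (-(m * y)) := by
    have := Finset.sum_le_card_nsmul Finset.univ (fun i => Real.exp (-m * affineForm c d i x))
      (Real.exp (-(m * y))) (fun i _ => Real.exp_le_exp.mpr (by nlinarith [hy i]))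
    simpa using this
  have := Real.log_le_log (sum_exp_pos c d m x) h
  rw [Real.log_mul (by simp) (Real.exp_pos _).ne', Real.log_exp] at this
  rw [negLogSumExp]
  linarith

lemma contDiff_negLogSumExp (m : ℝ) : ContDiff ℝ ∞ (negLogSumExp c d m) := by
  refine ContDiff.neg (ContDiff.log ?_ fun x => (sum_exp_pos c d m x).ne')
  exact ContDiff.sum fun i _ => (contDiff_const.mul (contDiff_affineForm c d i)).exp

lemma partialDeriv_negLogSumExp (m : ℝ) (j : Fin n) (x : Fin n → ℝ) :
    partialDeriv j (negLogSumExp c d m) x =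
      m * ∑ i, Real.exp (-m * affineForm c d i x) /
        (∑ l, Real.exp (-m * affineForm c d l x)) * d i j := by
  rw [partialDeriv, ← DifferentiableAt.lineDeriv_eq_fderiv
    ((contDiff_negLogSumExp c d m).differentiable (by simp) x), lineDeriv]
  have h1 : ∀ i, HasDerivAt (fun t : ℝ => Real.exp (-m * affineForm c d i (x + t • Pi.single j 1)))
      (Real.exp (-m * affineForm c d i x) * (-m * d i j)) 0 := by
    intro i
    simp only [affineForm_add_smul, dotProduct_single, mul_one]
    have := ((((hasDerivAt_id (0 : ℝ)).mul_const (d i j)).const_add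
      (affineForm c d i x)).const_mul (-m)).exp
    simpa using this
  have h2 := HasDerivAt.fun_sum (u := Finset.univ) fun i _ => h1 i
  have h3 := (h2.log (by simpa using (sum_exp_pos c d m x).ne')).neg
  refine h3.deriv.trans ?_
  simp only [zero_smul, add_zero]
  rw [Finset.sum_div, Finset.mul_sum, ← Finset.sum_neg_distrib]
  exact Finset.sum_congr rfl fun i _ => by ring

/-- Smooth functions compactly supported in the positivity set and approximating
`min (α i)` there as `m → ∞`. -/
noncomputable def smoothMin (m : ℝ) (x : Fin n → ℝ) : ℝ :=
  smoothCutoff (negLogSumExp c d m x) / m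

lemma partialDeriv_smoothMin {m : ℝ} (hm : 0 < m) (j : Fin n) (x : Fin n → ℝ) :
    partialDeriv j (smoothMin c d m) x =
      deriv smoothCutoff (negLogSumExp c d m x) *
        ∑ i, Real.exp (-m * affineForm c d i x) /
          (∑ l, Real.exp (-m * affineForm c d l x)) * d i j := by
  have h1 : HasFDerivAt (negLogSumExp c d m) (fderiv ℝ (negLogSumExp c d m) x) x :=
    ((contDiff_negLogSumExp c d m).differentiable (by simp) x).hasFDerivAt
  have h2 : HasDerivAt smoothCutoff (deriv smoothCutoff (negLogSumExp c d m x))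
      (negLogSumExp c d m x) :=
    (contDiff_smoothCutoff.differentiable (by simp) _).hasDerivAt
  have h3 := ((h2.comp_hasFDerivAt x h1).mul_const m⁻¹).fderiv
  have h4 : smoothMin c d m = fun x => (smoothCutoff ∘ negLogSumExp c d m) x * m⁻¹ := by
    funext x; rw [smoothMin, div_eq_mul_inv]; rfl
  have h5 := partialDeriv_negLogSumExp c d m j x
  rw [partialDeriv] at h5
  rw [partialDeriv, h4, h3]
  simp only [smul_apply, h5, smul_eq_mul]
  field_simp

lemma isTestFunction_smoothMin (hb : Bornology.IsBounded (positivitySet c d)) {m : ℝ}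
    (hm : 0 < m) (a : ℝ) :
    IsTestFunction (positivitySet c d) (fun x => a * smoothMin c d m x) := by
  have hclosed : IsClosed {x | ∀ i, 1 / m ≤ affineForm c d i x} := by
    rw [Set.ofPred_forall]
    exact isClosed_iInter fun i =>
      isClosed_le continuous_const (contDiff_affineForm c d i).continuous
  have hsub : {x | ∀ i, 1 / m ≤ affineForm c d i x} ⊆ positivitySet c d :=
    fun x hx i => lt_of_lt_of_le (by positivity) (hx i)
  have hsupp : Function.support (fun x => a * smoothMin c d m x) ⊆
      {x | ∀ i, 1 / m ≤ affineForm c d i x} := by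
    intro x hx i
    by_contra! hlt
    refine hx ?_
    have : negLogSumExp c d m x ≤ 1 := by
      refine (negLogSumExp_le c d m x i).trans ?_
      rw [lt_div_iff₀ hm] at hlt
      linarith
    simp [smoothMin, smoothCutoff_of_le_one this]
  refine ⟨contDiff_const.mul ((contDiff_smoothCutoff.comp
    (contDiff_negLogSumExp c d m)).div_const m), ?_, (closure_minimal hsupp hclosed).trans hsub⟩
  exact HasCompactSupport.of_support_subset_isCompact
    (Metric.isCompact_of_isClosed_isBounded hclosed (hb.subset hsub)) hsupp

variable {c d} in
lemma tendsto_negLogSumExp_div {x : Fin n → ℝ} {i : ι} (hi : x ∈ minCell c d i) :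
    Tendsto (fun m => negLogSumExp c d m x / m) atTop (𝓝 (affineForm c d i x)) := by
  have hmin : ∀ l, affineForm c d i x ≤ affineForm c d l x := fun l => by
    by_cases h : l = i
    · rw [h]
    · exact (hi l h).le
  have h1 : Tendsto (fun m : ℝ => affineForm c d i x - Real.log (Fintype.card ι) / m) atTop
      (𝓝 (affineForm c d i x)) := by
    simpa using tendsto_const_nhds.sub (tendsto_id.const_div_atTop (Real.log (Fintype.card ι)))
  refine tendsto_of_tendsto_of_tendsto_of_le_of_le' h1 tendsto_const_nhds ?_ ?_
  · filter_upwards [eventually_gt_atTop 0] with m hm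
    rw [le_div_iff₀ hm, sub_mul, div_mul_cancel₀ _ hm.ne', mul_comm]
    exact le_negLogSumExp c d hm.le hmin
  · filter_upwards [eventually_gt_atTop 0] with m hm
    rw [div_le_iff₀ hm, mul_comm]
    exact negLogSumExp_le c d m x i

variable {c d} in
lemma tendsto_negLogSumExp_atTop {x : Fin n → ℝ} {i : ι} (hi : x ∈ minCell c d i)
    (hx : x ∈ positivitySet c d) : Tendsto (fun m => negLogSumExp c d m x) atTop atTop := by
  have h := (tendsto_negLogSumExp_div hi).pos_mul_atTop (hx i) tendsto_id
  refine h.congr' ?_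
  filter_upwards [eventually_gt_atTop 0] with m hm
  simp only [id]
  rw [div_mul_cancel₀ _ hm.ne']

variable {c d} in
lemma tendsto_smoothMin {x : Fin n → ℝ} {i : ι} (hi : x ∈ minCell c d i)
    (hx : x ∈ positivitySet c d) :
    Tendsto (fun m => smoothMin c d m x) atTop (𝓝 (affineForm c d i x)) := by
  refine (tendsto_negLogSumExp_div hi).congr' ?_
  filter_upwards [(tendsto_negLogSumExp_atTop hi hx).eventually_ge_atTop 2] with m hm
  rw [smoothMin, smoothCutoff_of_two_le hm]

variable {c d} in
lemma tendsto_partialDeriv_smoothMin {x : Fin n → ℝ} {i : ι} (hi : x ∈ minCell c d i)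
    (hx : x ∈ positivitySet c d) (j : Fin n) :
    Tendsto (fun m => partialDeriv j (smoothMin c d m) x) atTop (𝓝 (d i j)) := by
  classical
  have h := tendsto_finsetSum Finset.univ fun l (_ : l ∈ Finset.univ) =>
    (tendsto_softmax hi l).mul_const (d l j)
  simp only [ite_mul, one_mul, zero_mul, Finset.sum_ite_eq', Finset.mem_univ, if_true] at h
  refine h.congr' ?_
  filter_upwards [(tendsto_negLogSumExp_atTop hi hx).eventually_gt_atTop 2,
    eventually_gt_atTop 0] with m hm hm0
  rw [partialDeriv_smoothMin c d hm0, deriv_smoothCutoff_of_two_lt hm, one_mul]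

/-- On a bounded positivity set, a multiple of the minimum of the affine functions lies in
`W₀^{1,∞}`, and its weak gradient is constant on each cell. -/
theorem isSobolevOneInftyZero_min (hb : Bornology.IsBounded (positivitySet c d))
    (hd : Function.Injective d) (a : ℝ) :
    IsSobolevOneInftyZero (positivitySet c d)
      (fun x => ∑ i, (minCell c d i).indicator (fun x => a * affineForm c d i x) x)
      (fun j x => ∑ i, (minCell c d i).indicator (fun _ => a * d i j) x) := by
  have hm : ∀ m : ℕ, (0 : ℝ) < m + 1 := fun m => by positivity
  have hseq : Tendsto (fun m : ℕ => (m : ℝ) + 1) atTop atTop :=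
    tendsto_atTop_add_const_right _ _ tendsto_natCast_atTop_atTop
  have hmeas := (isOpen_positivitySet c d).measurableSet
  have hcell : ∀ᵐ x ∂volume.restrict (positivitySet c d),
      (∃ i, x ∈ minCell c d i) ∧ x ∈ positivitySet c d :=
    (ae_restrict_of_ae (ae_exists_mem_minCell c d hd)).and (ae_restrict_mem hmeas)
  obtain ⟨K, hK⟩ := exists_abs_deriv_smoothCutoff_le
  obtain ⟨i₀⟩ := ‹Nonempty ι›
  have : Nonempty ι := ⟨i₀⟩
  obtain ⟨M, hM⟩ := hb.isCompact_closure.exists_bound_of_continuousOn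
    (contDiff_affineForm c d i₀).continuous.continuousOn
  have hK0 : 0 ≤ K := (abs_nonneg _).trans (hK 0)
  have hsum0 : 0 ≤ ∑ i, ∑ j, |d i j| :=
    Finset.sum_nonneg fun i _ => Finset.sum_nonneg fun j _ => abs_nonneg _
  have hpd : ∀ (m : ℕ) (j : Fin n) (x : Fin n → ℝ),
      partialDeriv j (fun x => a * smoothMin c d (m + 1) x) x =
        a * partialDeriv j (smoothMin c d (m + 1)) x := by
    intro m j x
    have hdiff : DifferentiableAt ℝ (smoothMin c d (m + 1)) x :=
      ((contDiff_smoothCutoff.comp (contDiff_negLogSumExp c d (m + 1))).div_const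
        ((m : ℝ) + 1)).differentiable (by simp) x
    rw [partialDeriv, fderiv_const_mul hdiff]
    rfl
  refine isSobolevOneInftyZero_of_tendsto (C := |a| * M + |a| * (K * ∑ i, ∑ j, |d i j|)) hmeas
    hb.measure_lt_top.ne (fun m => isTestFunction_smoothMin c d hb (hm m) a) ?_ ?_ ?_ ?_
  · intro m x hx
    have h1 : |smoothMin c d (m + 1) x| ≤ M := by
      rw [smoothMin, abs_div, abs_of_pos (hm m), div_le_iff₀ (hm m)]
      refine (abs_smoothCutoff_le _).trans ?_
      have h2 := negLogSumExp_le c d (m + 1) x i₀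
      have h3 := hx i₀
      have h4 : affineForm c d i₀ x ≤ M := (le_abs_self _).trans (hM x (subset_closure hx))
      have h5 := mul_le_mul_of_nonneg_left h4 (hm m).le
      have h6 := mul_pos (hm m) h3
      exact max_le (by linarith) (by linarith)
    rw [abs_mul]
    have := mul_le_mul_of_nonneg_left h1 (abs_nonneg a)
    have : 0 ≤ |a| * (K * ∑ i, ∑ j, |d i j|) := by positivity
    linarith
  · intro m j x hx
    have hM0 : 0 ≤ M := (norm_nonneg _).trans (hM x (subset_closure hx))
    rw [hpd, partialDeriv_smoothMin c d (hm m), abs_mul, abs_mul]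
    have h1 : |∑ i, Real.exp (-((m : ℝ) + 1) * affineForm c d i x) /
          (∑ l, Real.exp (-((m : ℝ) + 1) * affineForm c d l x)) * d i j| ≤ ∑ i, ∑ j, |d i j| := by
      refine (Finset.abs_sum_le_sum_abs _ _).trans (Finset.sum_le_sum fun i _ => ?_)
      have hZ := sum_exp_pos c d ((m : ℝ) + 1) x
      rw [abs_mul, abs_of_nonneg (div_nonneg (Real.exp_pos _).le hZ.le)]
      have h2 : Real.exp (-((m : ℝ) + 1) * affineForm c d i x) /
          (∑ l, Real.exp (-((m : ℝ) + 1) * affineForm c d l x)) ≤ 1 := by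
        rw [div_le_one hZ]
        exact Finset.single_le_sum
          (f := fun i => Real.exp (-((m : ℝ) + 1) * affineForm c d i x))
          (fun _ _ => (Real.exp_pos _).le) (Finset.mem_univ i)
      refine (mul_le_of_le_one_left (abs_nonneg _) h2).trans ?_
      exact Finset.single_le_sum (f := fun j => |d i j|) (fun _ _ => abs_nonneg _)
        (Finset.mem_univ j)
    have h2 := mul_le_mul (hK (negLogSumExp c d ((m : ℝ) + 1) x)) h1 (abs_nonneg _) hK0
    have h3 := mul_le_mul_of_nonneg_left h2 (abs_nonneg a)
    have h4 : 0 ≤ |a| * M := by positivity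
    linarith
  · filter_upwards [hcell] with x ⟨⟨i, hi⟩, hx⟩
    rw [sum_indicator_minCell c d hi]
    exact ((tendsto_smoothMin hi hx).comp hseq).const_mul a
  · intro j
    filter_upwards [hcell] with x ⟨⟨i, hi⟩, hx⟩
    rw [sum_indicator_minCell c d hi (fun i _ => a * d i j)]
    simp only [hpd]
    exact ((tendsto_partialDeriv_smoothMin hi hx j).comp hseq).const_mul a

end

/-! ### Convexity of quasiconvex functions along rank-one lines -/

/-- Testing quasiconvexity with the rank-one field `a ⊗ ∇ min (α i)` gives an inequality between
finitely many values of `w`. -/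
theorem IsQuasiconvex.le_sum_minCell {n : ℕ} {w : Matrix (Fin n) (Fin n) ℝ → ℝ}
    (hw : IsQuasiconvex fun X => (w X : EReal)) {ι : Type*} [Fintype ι] [Nonempty ι] {c : ι → ℝ}
    {d : ι → Fin n → ℝ} (hb : Bornology.IsBounded (positivitySet c d))
    (hd : Function.Injective d) (F : Matrix (Fin n) (Fin n) ℝ) (a : Fin n → ℝ) :
    volume.real (positivitySet c d) * w F ≤
      ∑ i, (volume.restrict (positivitySet c d)).real (minCell c d i) *
        w (F + Matrix.vecMulVec a (d i)) := by
  set Ω := positivitySet c d with hΩ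
  have hfin : IsFiniteMeasure (volume.restrict Ω) := ⟨by simpa using hb.measure_lt_top⟩
  set G : (Fin n → ℝ) → Matrix (Fin n) (Fin n) ℝ := fun x => Matrix.of fun i j =>
    ∑ l, (minCell c d l).indicator (fun _ => a i * d l j) x with hG
  have hGx : ∀ l x, x ∈ minCell c d l → G x = Matrix.vecMulVec a (d l) := by
    intro l x hx
    ext i j
    rw [Matrix.vecMulVec_apply]
    exact sum_indicator_minCell c d hx (fun l _ => a i * d l j)
  have hInt : ∀ l, Integrable (fun x => (minCell c d l).indicator
      (fun _ => w (F + Matrix.vecMulVec a (d l))) x) (volume.restrict Ω) := fun l =>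
    (integrable_const _).indicator (measurableSet_minCell c d l)
  have hae : (fun x => ∑ l, (minCell c d l).indicator
      (fun _ => w (F + Matrix.vecMulVec a (d l))) x) =ᵐ[volume.restrict Ω]
      fun x => w (F + G x) := by
    filter_upwards [ae_restrict_of_ae (ae_exists_mem_minCell c d hd)] with x ⟨l, hl⟩
    rw [sum_indicator_minCell c d hl (fun l _ => w (F + Matrix.vecMulVec a (d l))), hGx l x hl]
  -- `w` is not known to be measurable; its composition with the finitely valued field is.
  have hfi : Integrable (fun x => w (F + G x)) (volume.restrict Ω) :=
    (integrable_finsetSum _ fun l _ => hInt l).congr hae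
  have h := hw.2 Ω (isOpen_positivitySet c d) hb
    ((convex_positivitySet c d).addHaar_frontier volume) F
    (fun x i => ∑ l, (minCell c d l).indicator (fun x => a i * affineForm c d l x) x) G
    (fun i => isSobolevOneInftyZero_min c d hb hd (a i)) (extIntegralExists_coe hfi)
  rw [extIntegral_coe hfi, ← integral_congr_ae hae, integral_finsetSum _ fun l _ => hInt l] at h
  simp only [integral_indicator_const _ (measurableSet_minCell c d _), smul_eq_mul] at h
  rw [← EReal.coe_ennreal_toReal hb.measure_lt_top.ne, ← EReal.coe_mul,
    EReal.coe_le_coe_iff] at h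
  exact h

lemma sum_measureReal_minCell {n : ℕ} {ι : Type*} [Fintype ι] [Nonempty ι] {c : ι → ℝ}
    {d : ι → Fin n → ℝ} (hb : Bornology.IsBounded (positivitySet c d))
    (hd : Function.Injective d) :
    ∑ i, (volume.restrict (positivitySet c d)).real (minCell c d i) =
      volume.real (positivitySet c d) := by
  set Ω := positivitySet c d with hΩ
  have hfin : IsFiniteMeasure (volume.restrict Ω) := ⟨by simpa using hb.measure_lt_top⟩
  have hae : (fun x => ∑ l, (minCell c d l).indicator (fun _ => (1 : ℝ)) x)
      =ᵐ[volume.restrict Ω] fun _ => 1 := by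
    filter_upwards [ae_restrict_of_ae (ae_exists_mem_minCell c d hd)] with x ⟨l, hl⟩
    rw [sum_indicator_minCell c d hl (fun _ _ => (1 : ℝ))]
  have h := integral_congr_ae hae
  rw [integral_finsetSum _ fun l _ =>
    (integrable_const _).indicator (measurableSet_minCell c d l)] at h
  simp only [integral_indicator_const _ (measurableSet_minCell c d _), smul_eq_mul, mul_one] at h
  rw [h]
  simp

/-- The mean value of the gradient of the minimum over its positivity set vanishes. -/
lemma sum_measureReal_minCell_mul_eq_zero {n : ℕ} {ι : Type*} [Fintype ι] [Nonempty ι] {c : ι → ℝ}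
    {d : ι → Fin n → ℝ} (hb : Bornology.IsBounded (positivitySet c d))
    (hd : Function.Injective d) (j : Fin n) :
    ∑ i, (volume.restrict (positivitySet c d)).real (minCell c d i) * d i j = 0 := by
  have hfin : IsFiniteMeasure (volume.restrict (positivitySet c d)) :=
    ⟨by simpa using hb.measure_lt_top⟩
  have h := (isSobolevOneInftyZero_min c d hb hd 1).integral_eq_zero j
  rw [integral_finsetSum _ fun l _ =>
    (integrable_const _).indicator (measurableSet_minCell c d l)] at h
  simpa only [integral_indicator_const _ (measurableSet_minCell c d _), smul_eq_mul,
    one_mul] using h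

/-- Constants of the affine functions whose minimum is a tent of height at most `t (1 - t)` in
direction `k`, cut off at distance `R` in the other directions. -/
def tentConst {n : ℕ} (k : Fin n) (t R : ℝ) (i : Fin n × Bool) : ℝ :=
  if i.1 = k then t * (1 - t) else R

/-- Slopes of the tent: `1 - t` and `-t` in direction `k`, and `±1` in the other directions. -/
def tentSlope {n : ℕ} (k : Fin n) (t : ℝ) (i : Fin n × Bool) : ℝ :=
  if i.1 = k then (if i.2 then 1 - t else -t) else (if i.2 then 1 else -1)

/-- Gradients of the affine functions of the tent, with respect to the orthonormal frame formed by
the rows of `B`. -/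
def tentGrad {n : ℕ} (B : Matrix (Fin n) (Fin n) ℝ) (k : Fin n) (t : ℝ) (i : Fin n × Bool) :
    Fin n → ℝ :=
  tentSlope k t i • B i.1

lemma tentSlope_ne_zero {n : ℕ} {k : Fin n} {t : ℝ} (h0 : 0 < t) (h1 : t < 1)
    (i : Fin n × Bool) : tentSlope k t i ≠ 0 := by
  unfold tentSlope
  split_ifs <;> linarith

lemma dotProduct_row_of_orthogonal {n : ℕ} {B : Matrix (Fin n) (Fin n) ℝ}
    (hB : B ∈ Matrix.orthogonalGroup (Fin n) ℝ) (i j : Fin n) :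
    B i ⬝ᵥ B j = if i = j then 1 else 0 := by
  have h := congrFun (congrFun ((Matrix.mem_orthogonalGroup_iff (Fin n) ℝ).mp hB) i) j
  rw [Matrix.one_apply] at h
  exact h

lemma tentGrad_dotProduct {n : ℕ} {B : Matrix (Fin n) (Fin n) ℝ}
    (hB : B ∈ Matrix.orthogonalGroup (Fin n) ℝ) (k : Fin n) (t : ℝ) (i : Fin n × Bool)
    (j : Fin n) : tentGrad B k t i ⬝ᵥ B j = if i.1 = j then tentSlope k t i else 0 := by
  rw [tentGrad, smul_dotProduct, dotProduct_row_of_orthogonal hB]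
  simp

lemma injective_tentGrad {n : ℕ} {B : Matrix (Fin n) (Fin n) ℝ}
    (hB : B ∈ Matrix.orthogonalGroup (Fin n) ℝ) {k : Fin n} {t : ℝ} (h0 : 0 < t) (h1 : t < 1) :
    Function.Injective (tentGrad B k t) := by
  rintro ⟨i, σ⟩ ⟨j, τ⟩ h
  have h2 := congrArg (fun v => v ⬝ᵥ B i) h
  simp only [tentGrad_dotProduct hB, if_true] at h2
  by_cases hij : j = i
  · subst hij
    simp only [if_true] at h2
    have : σ = τ := by
      unfold tentSlope at h2
      by_cases hjk : j = k <;> cases σ <;> cases τ <;> simp [hjk] at h2 ⊢ <;> linarith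
    rw [this]
  · rw [if_neg hij] at h2
    exact absurd h2 (tentSlope_ne_zero h0 h1 _)

lemma affineForm_tent {n : ℕ} (B : Matrix (Fin n) (Fin n) ℝ) (k : Fin n) (t R : ℝ)
    (i : Fin n × Bool) (x : Fin n → ℝ) :
    affineForm (tentConst k t R) (tentGrad B k t) i x =
      tentConst k t R i + tentSlope k t i * (B i.1 ⬝ᵥ x) := by
  rw [affineForm, tentGrad, smul_dotProduct, smul_eq_mul]

lemma abs_lt_of_mem_positivitySet_tent {n : ℕ} {B : Matrix (Fin n) (Fin n) ℝ} {k : Fin n}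
    {t R : ℝ} {x : Fin n → ℝ}
    (hx : x ∈ positivitySet (tentConst k t R) (tentGrad B k t)) {j : Fin n} (hj : j ≠ k) :
    |B j ⬝ᵥ x| < R := by
  have h1 := hx (j, true)
  have h2 := hx (j, false)
  simp only [affineForm_tent, tentConst, tentSlope, hj, if_false, if_true] at h1 h2
  rw [abs_lt]
  simp at h2
  constructor <;> linarith

lemma isBounded_positivitySet_tent {n : ℕ} {B : Matrix (Fin n) (Fin n) ℝ}
    (hB : B ∈ Matrix.orthogonalGroup (Fin n) ℝ) {k : Fin n} {t R : ℝ} (h0 : 0 < t) (h1 : t < 1)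
    (hR : 1 < R) : Bornology.IsBounded (positivitySet (tentConst k t R) (tentGrad B k t)) := by
  rw [isBounded_iff_forall_norm_le]
  have hy : ∀ x ∈ positivitySet (tentConst k t R) (tentGrad B k t), ∀ j, |B j ⬝ᵥ x| ≤ R := by
    intro x hx j
    by_cases hj : j = k
    · subst hj
      have h2 := hx (j, true)
      have h3 := hx (j, false)
      simp only [affineForm_tent, tentConst, tentSlope, if_true] at h2 h3
      simp at h3
      have h4 : -t < B j ⬝ᵥ x := by
        by_contra! hcon
        nlinarith
      have h5 : B j ⬝ᵥ x < 1 - t := by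
        by_contra! hcon
        nlinarith
      rw [abs_le]
      constructor <;> linarith
    · exact (abs_lt_of_mem_positivitySet_tent hx hj).le
  have hR0 : 0 ≤ R := by linarith
  refine ⟨∑ i, ∑ j, |B j i| * R, fun x hx => ?_⟩
  have hnn : 0 ≤ ∑ i, ∑ j, |B j i| * R := by positivity
  rw [pi_norm_le_iff_of_nonneg hnn]
  intro i
  have e : x i = ∑ j, B j i * (B j ⬝ᵥ x) := by
    have h2 : B.transpose.mulVec (B.mulVec x) = x := by
      have h3 : B.transpose * B = 1 := (Matrix.mem_orthogonalGroup_iff' (Fin n) ℝ).mp hB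
      rw [Matrix.mulVec_mulVec, h3, Matrix.one_mulVec]
    exact (congrFun h2 i).symm
  rw [e, Real.norm_eq_abs]
  refine (Finset.abs_sum_le_sum_abs _ _).trans ?_
  refine le_trans (Finset.sum_le_sum fun j _ => ?_)
    (Finset.single_le_sum (f := fun i => ∑ j, |B j i| * R)
      (fun i _ => by positivity) (Finset.mem_univ i))
  rw [abs_mul]
  exact mul_le_mul_of_nonneg_left (hy x hx j) (abs_nonneg _)

lemma zero_mem_positivitySet_tent {n : ℕ} (B : Matrix (Fin n) (Fin n) ℝ) (k : Fin n) {t R : ℝ}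
    (h0 : 0 < t) (h1 : t < 1) (hR : 1 < R) :
    (0 : Fin n → ℝ) ∈ positivitySet (tentConst k t R) (tentGrad B k t) := by
  intro i
  rw [affineForm_tent, dotProduct_zero, mul_zero, add_zero, tentConst]
  split_ifs
  · exact mul_pos h0 (by linarith)
  · linarith

/-- After shrinking the domain by the factor `(R - 1) / R`, only the two slopes in direction `k`
are active: there the cut-off is above the height of the tent. -/
lemma notMem_minCell_of_shrink {n : ℕ} {B : Matrix (Fin n) (Fin n) ℝ} {k : Fin n} {t R : ℝ}
    (h0 : 0 < t) (h1 : t < 1) (hR : 1 < R) {x : Fin n → ℝ}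
    (hx : x ∈ positivitySet (tentConst k t R) (tentGrad B k t)) {i : Fin n × Bool} (hi : i.1 ≠ k) :
    ((R - 1) / R) • x ∉ minCell (tentConst k t R) (tentGrad B k t) i := by
  intro hmem
  have hR0 : 0 < R := by linarith
  set r := (R - 1) / R with hr
  have hr0 : 0 < r := div_pos (by linarith) hR0
  have hrR : r * R = R - 1 := div_mul_cancel₀ _ hR0.ne'
  have h2 := hmem (k, true) fun h => hi (by rw [← h])
  have h3 := hmem (k, false) fun h => hi (by rw [← h])
  simp only [affineForm_tent, dotProduct_smul, smul_eq_mul] at h2 h3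
  have hlow : 1 < tentConst k t R i + tentSlope k t i * (r * (B i.1 ⬝ᵥ x)) := by
    have hy := abs_lt.mp (abs_lt_of_mem_positivitySet_tent hx hi)
    have h4 := mul_lt_mul_of_pos_left hy.1 hr0
    have h5 := mul_lt_mul_of_pos_left hy.2 hr0
    simp only [tentConst, tentSlope, hi, if_false]
    split_ifs <;> linarith
  have hc : t * (1 - t) ≤ 1 := by nlinarith
  simp only [tentConst, tentSlope, if_true] at h2 h3 hlow
  simp only [Bool.false_eq_true, if_false] at h3
  rcases le_total (r * (B k ⬝ᵥ x)) 0 with h | h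
  · nlinarith
  · nlinarith

open Pointwise in
/-- Quasiconvexity tested with a tent of width one, cut off at distance `R` in the directions
orthogonal to the tent. The error term is the volume fraction of the cut-off region. -/
lemma IsQuasiconvex.le_add_error {n : ℕ} {w : Matrix (Fin n) (Fin n) ℝ → ℝ}
    (hw : IsQuasiconvex fun X => (w X : EReal)) {B : Matrix (Fin n) (Fin n) ℝ}
    (hB : B ∈ Matrix.orthogonalGroup (Fin n) ℝ) (k : Fin n) {t : ℝ} (h0 : 0 < t) (h1 : t < 1)
    (F : Matrix (Fin n) (Fin n) ℝ) (a : Fin n → ℝ) :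
    ∃ K, ∀ R, 1 < R → w F ≤ t * w (F + (1 - t) • Matrix.vecMulVec a (B k)) +
      (1 - t) * w (F + (-t) • Matrix.vecMulVec a (B k)) + (1 - ((R - 1) / R) ^ n) * K := by
  set d := tentGrad B k t with hddef
  set wi : Fin n × Bool → ℝ := fun i => w (F + Matrix.vecMulVec a (d i)) with hwi
  -- The finitely many values of `w` involved, hence `M`, do not depend on `R`.
  set M := ∑ i, |wi i| with hM
  have hwk : ∀ σ, wi (k, σ) =
      w (F + tentSlope k t (k, σ) • Matrix.vecMulVec a (B k)) := by
    intro σ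
    rw [hwi, hddef]
    simp only [tentGrad, Matrix.vecMulVec_smul]
  have hwt : wi (k, true) = w (F + (1 - t) • Matrix.vecMulVec a (B k)) := by
    rw [hwk]; simp [tentSlope]
  have hwf : wi (k, false) = w (F + (-t) • Matrix.vecMulVec a (B k)) := by
    rw [hwk]; simp [tentSlope]
  rw [← hwt, ← hwf]
  refine ⟨|M - (t * wi (k, true) + (1 - t) * wi (k, false))|, fun R hR => ?_⟩
  have hne : Nonempty (Fin n × Bool) := ⟨(k, true)⟩
  set c := tentConst k t R with hc
  have hd : Function.Injective d := injective_tentGrad hB h0 h1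
  have hb : Bornology.IsBounded (positivitySet c d) := isBounded_positivitySet_tent hB h0 h1 hR
  have hmain := hw.le_sum_minCell hb hd F a
  have htot := sum_measureReal_minCell hb hd
  have hzero := sum_measureReal_minCell_mul_eq_zero hb hd
  set Ω := positivitySet c d with hΩ
  set p : Fin n × Bool → ℝ := fun i => (volume.restrict Ω).real (minCell c d i) with hp
  set v := volume.real Ω with hv
  have hp0 : ∀ i, 0 ≤ p i := fun i => measureReal_nonneg
  have hΩtop : volume Ω ≠ ⊤ := hb.measure_lt_top.ne
  have hvpos : 0 < v := ENNReal.toReal_pos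
    ((isOpen_positivitySet c d).measure_pos volume
      ⟨0, zero_mem_positivitySet_tent B k h0 h1 hR⟩).ne' hΩtop
  -- The mean value of the gradient vanishes; its component in direction `k` fixes the ratio of
  -- the two volume fractions.
  have hratio : (1 - t) * p (k, true) - t * p (k, false) = 0 := by
    have h2 : ∑ i, p i * (d i ⬝ᵥ B k) = 0 := by
      simp only [dotProduct, Finset.mul_sum]
      rw [Finset.sum_comm]
      refine Finset.sum_eq_zero fun j _ => ?_
      have := congrArg (fun r => r * B k j) (hzero j)
      simpa only [Finset.sum_mul, zero_mul, mul_assoc] using this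
    simp only [hddef, tentGrad_dotProduct hB, Fintype.sum_prod_type, Fintype.sum_bool] at h2
    rw [Finset.sum_eq_single k (fun j _ hj => by simp [hj]) (by simp)] at h2
    simp [tentSlope] at h2
    linarith
  have hsplit : ∀ f : Fin n × Bool → ℝ, ∑ i, f i = f (k, true) + f (k, false) +
      ∑ j ∈ Finset.univ.erase k, (f (j, true) + f (j, false)) := by
    intro f
    rw [Fintype.sum_prod_type, ← Finset.add_sum_erase _ _ (Finset.mem_univ k)]
    simp only [Fintype.sum_bool]
  have hrest : ∑ j ∈ Finset.univ.erase k,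
      (p (j, true) * wi (j, true) + p (j, false) * wi (j, false)) ≤
      M * ∑ j ∈ Finset.univ.erase k, (p (j, true) + p (j, false)) := by
    rw [Finset.mul_sum]
    refine Finset.sum_le_sum fun j _ => ?_
    have hle : ∀ i, wi i ≤ M := fun i => (le_abs_self _).trans
      (Finset.single_le_sum (f := fun i => |wi i|) (fun _ _ => abs_nonneg _) (Finset.mem_univ i))
    have h2 := mul_le_mul_of_nonneg_left (hle (j, true)) (hp0 (j, true))
    have h3 := mul_le_mul_of_nonneg_left (hle (j, false)) (hp0 (j, false))
    linarith
  have hr0 : 0 ≤ (R - 1) / R := div_nonneg (by linarith) (by linarith)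
  have hr1 : (R - 1) / R ≤ 1 := by rw [div_le_one (by linarith)]; linarith
  have hshrink : ((R - 1) / R) ^ n * v ≤ p (k, true) + p (k, false) := by
    have hsub : ((R - 1) / R) • Ω ⊆ Ω := by
      rintro _ ⟨x, hx, rfl⟩
      exact (convex_positivitySet c d).smul_mem_of_zero_mem
        (zero_mem_positivitySet_tent B k h0 h1 hR) hx ⟨hr0, hr1⟩
    have h2 : volume (((R - 1) / R) • Ω) ≤
        (volume.restrict Ω) (minCell c d (k, true)) +
          (volume.restrict Ω) (minCell c d (k, false)) := by
      rw [← Measure.restrict_eq_self volume hsub]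
      refine le_trans (measure_mono_ae ?_) (measure_union_le _ _)
      filter_upwards [ae_restrict_of_ae (ae_exists_mem_minCell c d hd)] with y hy hyr
      obtain ⟨⟨j, σ⟩, hj⟩ := hy
      obtain ⟨x, hx, rfl⟩ := hyr
      by_cases hjk : j = k
      · subst hjk
        cases σ
        · exact Or.inr hj
        · exact Or.inl hj
      · exact absurd hj (notMem_minCell_of_shrink h0 h1 hR hx hjk)
    rw [Measure.addHaar_smul_of_nonneg volume hr0, Module.finrank_fin_fun] at h2
    have hfin : IsFiniteMeasure (volume.restrict Ω) := ⟨by simpa using hΩtop.lt_top⟩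
    have h3 := ENNReal.toReal_mono (by finiteness) h2
    rw [ENNReal.toReal_mul, ENNReal.toReal_ofReal (by positivity),
      ENNReal.toReal_add (by finiteness) (by finiteness)] at h3
    exact h3
  rw [hsplit] at hmain htot
  set Q := ∑ j ∈ Finset.univ.erase k, (p (j, true) + p (j, false)) with hQ
  have hQle : Q ≤ (1 - ((R - 1) / R) ^ n) * v := by
    linarith
  have hQ0 : 0 ≤ Q := Finset.sum_nonneg fun j _ => add_nonneg (hp0 _) (hp0 _)
  have e1 : p (k, true) = t * (v - Q) := by linear_combination hratio + t * htot
  have e2 : p (k, false) = (1 - t) * (v - Q) := by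
    linear_combination (1 - t) * htot - hratio
  set A := t * wi (k, true) + (1 - t) * wi (k, false) with hA
  have h5 : v * w F ≤ (v - Q) * A + M * Q := by
    have h6 : p (k, true) * wi (k, true) + p (k, false) * wi (k, false) = (v - Q) * A := by
      rw [e1, e2]; ring
    linarith
  have h7 : Q * (M - A) ≤ (1 - ((R - 1) / R) ^ n) * v * |M - A| :=
    (mul_le_mul_of_nonneg_left (le_abs_self _) hQ0).trans
      (mul_le_mul_of_nonneg_right hQle (abs_nonneg _))
  have h8 : v * w F ≤ v * (A + (1 - ((R - 1) / R) ^ n) * |M - A|) := by nlinarith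
  exact le_of_mul_le_mul_left h8 hvpos

theorem IsQuasiconvex.le_rankOne {n : ℕ} {w : Matrix (Fin n) (Fin n) ℝ → ℝ}
    (hw : IsQuasiconvex fun X => (w X : EReal)) {B : Matrix (Fin n) (Fin n) ℝ}
    (hB : B ∈ Matrix.orthogonalGroup (Fin n) ℝ) (k : Fin n) {t : ℝ} (h0 : 0 < t) (h1 : t < 1)
    (F : Matrix (Fin n) (Fin n) ℝ) (a : Fin n → ℝ) :
    w F ≤ t * w (F + (1 - t) • Matrix.vecMulVec a (B k)) +
      (1 - t) * w (F + (-t) • Matrix.vecMulVec a (B k)) := by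
  obtain ⟨K, hK⟩ := hw.le_add_error hB k h0 h1 F a
  have hlim : Tendsto (fun R : ℝ => (R - 1) / R) atTop (𝓝 1) := by
    have h2 : Tendsto (fun R : ℝ => 1 - 1 / R) atTop (𝓝 1) := by
      simpa using tendsto_const_nhds.sub (tendsto_id.const_div_atTop (1 : ℝ))
    refine h2.congr' ?_
    filter_upwards [eventually_gt_atTop 0] with R hR
    field_simp
  have h3 := (((hlim.pow n).const_sub 1).mul_const K).const_add
    (t * w (F + (1 - t) • Matrix.vecMulVec a (B k)) +
      (1 - t) * w (F + (-t) • Matrix.vecMulVec a (B k)))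
  rw [one_pow, sub_self, zero_mul, add_zero] at h3
  exact ge_of_tendsto h3 ((eventually_gt_atTop 1).mono fun R hR => hK R hR)

/-- A finite quasiconvex function is convex along the lines spanned by `a ⊗ b`, for `b` a row of
an orthogonal matrix. -/
theorem IsQuasiconvex.convexOn_rankOne {n : ℕ} {w : Matrix (Fin n) (Fin n) ℝ → ℝ}
    (hw : IsQuasiconvex fun X => (w X : EReal)) {B : Matrix (Fin n) (Fin n) ℝ}
    (hB : B ∈ Matrix.orthogonalGroup (Fin n) ℝ) (k : Fin n)
    (F : Matrix (Fin n) (Fin n) ℝ) (a : Fin n → ℝ) :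
    ConvexOn ℝ Set.univ fun s : ℝ => w (F + s • Matrix.vecMulVec a (B k)) := by
  refine convexOn_iff_forall_pos.mpr ⟨convex_univ, fun x _ y _ α β hα hβ hαβ => ?_⟩
  have hα' : α = 1 - β := by linarith
  subst hα'
  have h := hw.le_rankOne hB k hβ (by linarith)
    (F + ((1 - β) * x + β * y) • Matrix.vecMulVec a (B k)) ((y - x) • a)
  have e1 : F + ((1 - β) * x + β * y) • Matrix.vecMulVec a (B k) +
      (1 - β) • Matrix.vecMulVec ((y - x) • a) (B k) = F + y • Matrix.vecMulVec a (B k) := by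
    rw [Matrix.smul_vecMulVec]; module
  have e2 : F + ((1 - β) * x + β * y) • Matrix.vecMulVec a (B k) +
      (-β) • Matrix.vecMulVec ((y - x) • a) (B k) = F + x • Matrix.vecMulVec a (B k) := by
    rw [Matrix.smul_vecMulVec]; module
  rw [e1, e2] at h
  simp only [smul_eq_mul]
  linarith

/-! ### Finite convex, rank-one convex and polyconvex functions -/

lemma exists_real_of_le_coe {V : Type*} {w : V → EReal} {f : V → ℝ} (h : ∀ x, w x ≠ ⊥)
    (hle : ∀ x, w x ≤ (f x : EReal)) : ∃ w' : V → ℝ, w = fun x => (w' x : EReal) :=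
  ⟨fun x => (w x).toReal, funext fun x =>
    (EReal.coe_toReal (ne_top_of_le_ne_top (EReal.coe_ne_top _) (hle x)) (h x)).symm⟩

lemma coe_le_coe_mul_add_coe_mul_iff {a b c s t : ℝ} :
    (a : EReal) ≤ (s : EReal) * (b : EReal) + (t : EReal) * (c : EReal) ↔ a ≤ s * b + t * c := by
  rw [← EReal.coe_mul, ← EReal.coe_mul, ← EReal.coe_add, EReal.coe_le_coe_iff]

lemma isConvexFun_coe {V : Type*} [AddCommGroup V] [Module ℝ V] {f : V → ℝ}
    (h : ∀ x y, ∀ t : ℝ, 0 ≤ t → t ≤ 1 →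
      f ((1 - t) • x + t • y) ≤ (1 - t) * f x + t * f y) :
    IsConvexFun fun x => (f x : EReal) :=
  ⟨fun _ => EReal.coe_ne_bot _, fun x y t h0 h1 => 
    coe_le_coe_mul_add_coe_mul_iff.mpr (h x y t h0 h1)⟩

lemma IsConvexFun.isRankOneConvex {n : ℕ} {w : Matrix (Fin n) (Fin n) ℝ → EReal}
    (h : IsConvexFun w) : IsRankOneConvex w :=
  ⟨h.1, fun F₁ F₂ _ => h.2 F₁ F₂⟩

/-- A convex function is polyconvex, because the entries of a matrix are its minors of order
one. -/
lemma IsConvexFun.isPolyconvex {n : ℕ} {w : Matrix (Fin n) (Fin n) ℝ → EReal}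
    (h : IsConvexFun w) : IsPolyconvex w := by
  have hpos : ∀ i : Fin n, 0 < n := fun i => lt_of_le_of_lt (Nat.zero_le _) i.isLt
  let single : Fin n → (Fin 1 ↪o Fin n) := fun i => OrderEmbedding.ofStrictMono (fun _ => i)
    fun a b hab => absurd hab (by rw [Subsingleton.elim a b]; exact lt_irrefl _)
  let ent : (MinorIndex n → ℝ) → Matrix (Fin n) (Fin n) ℝ := fun M => Matrix.of fun i j =>
    M ⟨⟨0, hpos i⟩, single i, single j⟩
  refine ⟨fun M => w (ent M), ⟨fun _ => h.1 _, fun M N t h0 h1 => h.2 (ent M) (ent N) t h0 h1⟩,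
    fun F => congrArg w ?_⟩
  ext i j
  exact (Matrix.det_fin_one (F.submatrix (single i) (single j))).symm

lemma IsPolyconvex.ne_bot {n : ℕ} {w : Matrix (Fin n) (Fin n) ℝ → EReal} (h : IsPolyconvex w)
    (F : Matrix (Fin n) (Fin n) ℝ) : w F ≠ ⊥ := by
  obtain ⟨P, hP, hw⟩ := h
  rw [hw]
  exact hP.1 _

/-- The determinant is affine along rank-one lines: it is the determinant of a bordered matrix,
one column of which is affine in the parameter. -/
lemma exists_det_add_smul_vecMulVec {m : ℕ} (A : Matrix (Fin m) (Fin m) ℝ) (a b : Fin m → ℝ) :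
    ∃ p q : ℝ, ∀ s : ℝ, (A + s • Matrix.vecMulVec a b).det = p + s * q := by
  let N : Matrix (Fin 1 ⊕ Fin m) (Fin 1 ⊕ Fin m) ℝ :=
    Matrix.fromBlocks 1 (Matrix.replicateRow (Fin 1) b) 0 A
  let e : Fin 1 ⊕ Fin m → ℝ := Sum.elim (fun _ => 1) (fun _ => 0)
  let a' : Fin 1 ⊕ Fin m → ℝ := Sum.elim (fun _ => 0) (fun i => -a i)
  refine ⟨(N.updateCol (Sum.inl 0) e).det, (N.updateCol (Sum.inl 0) a').det, fun s => ?_⟩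
  rw [← Matrix.det_updateCol_smul, ← Matrix.det_updateCol_add]
  have h : N.updateCol (Sum.inl 0) (e + s • a') =
      Matrix.fromBlocks 1 (Matrix.replicateRow (Fin 1) b)
        (Matrix.replicateCol (Fin 1) (-(s • a))) A := by
    ext i j
    rcases i with i | i <;> rcases j with j | j <;>
      simp [N, e, a', Subsingleton.elim _ (0 : Fin 1)]
  rw [h, Matrix.det_fromBlocks_one₁₁]
  congr 1
  ext i j
  simp [Matrix.mul_apply, Matrix.vecMulVec_apply, mul_assoc]

lemma minors_add_smul_vecMulVec {n : ℕ} (F : Matrix (Fin n) (Fin n) ℝ) (a b : Fin n → ℝ)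
    (x y t : ℝ) : minors (F + ((1 - t) * x + t * y) • Matrix.vecMulVec a b) =
      (1 - t) • minors (F + x • Matrix.vecMulVec a b) +
        t • minors (F + y • Matrix.vecMulVec a b) := by
  funext I
  obtain ⟨p, q, h⟩ := exists_det_add_smul_vecMulVec (F.submatrix I.2.1 I.2.2)
    (fun i => a (I.2.1 i)) (fun j => b (I.2.2 j))
  have h' : ∀ s : ℝ, minors (F + s • Matrix.vecMulVec a b) I = p + s * q := fun s => by
    rw [← h s]; rfl
  simp only [Pi.add_apply, Pi.smul_apply, smul_eq_mul, h']
  ring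

lemma IsPolyconvex.convexOn_rankOne {n : ℕ} {w : Matrix (Fin n) (Fin n) ℝ → ℝ}
    (hw : IsPolyconvex fun X => (w X : EReal)) (F : Matrix (Fin n) (Fin n) ℝ)
    (a b : Fin n → ℝ) :
    ConvexOn ℝ Set.univ fun s : ℝ => w (F + s • Matrix.vecMulVec a b) := by
  obtain ⟨P, hP, hwP⟩ := hw
  refine ⟨convex_univ, fun x _ y _ α β hα hβ hαβ => ?_⟩
  have hα' : α = 1 - β := by linarith
  subst hα'
  have h := hP.2 (minors (F + x • Matrix.vecMulVec a b)) (minors (F + y • Matrix.vecMulVec a b)) β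
    hβ (by linarith)
  rw [← minors_add_smul_vecMulVec, ← hwP, ← hwP, ← hwP] at h
  exact coe_le_coe_mul_add_coe_mul_iff.mp h

lemma IsRankOneConvex.convexOn_rankOne {n : ℕ} {w : Matrix (Fin n) (Fin n) ℝ → ℝ}
    (hw : IsRankOneConvex fun X => (w X : EReal)) (F : Matrix (Fin n) (Fin n) ℝ)
    (a b : Fin n → ℝ) :
    ConvexOn ℝ Set.univ fun s : ℝ => w (F + s • Matrix.vecMulVec a b) := by
  refine ⟨convex_univ, fun x _ y _ α β hα hβ hαβ => ?_⟩
  have hα' : α = 1 - β := by linarith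
  subst hα'
  set F₁ := F + x • Matrix.vecMulVec a b with hF₁
  set F₂ := F + y • Matrix.vecMulVec a b with hF₂
  have hsub : F₂ - F₁ = Matrix.vecMulVec ((y - x) • a) b := by
    rw [Matrix.smul_vecMulVec]; module
  have hcomb : F + ((1 - β) • x + β • y) • Matrix.vecMulVec a b = (1 - β) • F₁ + β • F₂ := by
    rw [hF₁, hF₂]; simp only [smul_eq_mul]; module
  change w (F + ((1 - β) • x + β • y) • Matrix.vecMulVec a b) ≤ (1 - β) * w F₁ + β * w F₂
  rw [hcomb]
  by_cases h0 : F₂ - F₁ = 0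
  · rw [sub_eq_zero.mp h0, ← add_smul]
    simp only [sub_add_cancel, one_smul]
    linarith
  · have hrank : (F₂ - F₁).rank = 1 := by
      refine le_antisymm (hsub ▸ Matrix.rank_vecMulVec_le _ _) ?_
      rw [Nat.one_le_iff_ne_zero]
      intro h
      rw [Matrix.rank, Submodule.finrank_eq_zero, LinearMap.range_eq_bot] at h
      exact h0 (Matrix.toLin'.injective (by rw [Matrix.toLin'_apply', h, map_zero]))
    have h := hw.2 F₁ F₂ hrank β hβ (by linarith)
    exact coe_le_coe_mul_add_coe_mul_iff.mp h

/-! ### The convex envelope on the line -/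

lemma le_envelope {V : Type*} {P : (V → EReal) → Prop} {f w : V → EReal} (hP : P w)
    (hle : ∀ y, w y ≤ f y) (x : V) : w x ≤ envelope P f x :=
  le_sSup ⟨w, hP, hle, rfl⟩

lemma envelope_le {V : Type*} {P : (V → EReal) → Prop} {f : V → EReal} {x : V} {a : EReal}
    (h : ∀ w, P w → (∀ y, w y ≤ f y) → w x ≤ a) : envelope P f x ≤ a := by
  refine sSup_le ?_
  rintro _ ⟨w, hP, hle, rfl⟩
  exact h w hP hle

/-- The convex envelope of a real even function that is bounded below is real, convex and even,
and it is the greatest convex minorant. -/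
theorem exists_real_convexEnvelope {e : ℝ → ℝ} {m : ℝ} (hm : ∀ t, m ≤ e t)
    (heven : ∀ t, e (-t) = e t) :
    ∃ g : ℝ → ℝ, (∀ t, convexEnvelope (fun t => (e t : EReal)) t = (g t : EReal)) ∧
      ConvexOn ℝ Set.univ g ∧ (∀ t, g (-t) = g t) ∧ (∀ t, g t ≤ e t) ∧
      ∀ f : ℝ → ℝ, ConvexOn ℝ Set.univ f → (∀ t, f t ≤ e t) → ∀ t, f t ≤ g t := by
  have hle : ∀ t, convexEnvelope (fun t => (e t : EReal)) t ≤ (e t : EReal) := fun t =>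
    envelope_le fun w _ hw => hw t
  have hmax : ∀ f : ℝ → ℝ, ConvexOn ℝ Set.univ f → (∀ t, f t ≤ e t) → ∀ t,
      (f t : EReal) ≤ convexEnvelope (fun t => (e t : EReal)) t := fun f hf hfe =>
    le_envelope (P := IsConvexFun) (w := fun t => (f t : EReal))
      (isConvexFun_coe fun x y t h0 h1 => hf.2 (Set.mem_univ _) (Set.mem_univ _)
        (sub_nonneg.mpr h1) h0 (by ring))
      (fun t => EReal.coe_le_coe_iff.mpr (hfe t))
  obtain ⟨g, hg⟩ := exists_real_of_le_coe (w := convexEnvelope fun t => (e t : EReal)) (f := e)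
    (fun t => ne_bot_of_le_ne_bot (EReal.coe_ne_bot m)
      (hmax (fun _ => m) (convexOn_const m convex_univ) hm t)) hle
  have hgt : ∀ t, convexEnvelope (fun t => (e t : EReal)) t = (g t : EReal) := congrFun hg
  have hmax' : ∀ w : ℝ → EReal, IsConvexFun w → (∀ t, w t ≤ (e t : EReal)) → ∀ t,
      w t ≤ (g t : EReal) := fun w hw hwe t => hgt t ▸ le_envelope (P := IsConvexFun) hw hwe t
  have hneg : ∀ t, g (-t) ≤ g t := by
    intro t
    rw [← EReal.coe_le_coe_iff, ← hgt (-t)]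
    refine envelope_le fun w hw hwe => ?_
    refine hmax' (fun s => w (-s)) ⟨fun s => hw.1 _, fun x y s h0 h1 => ?_⟩
      (fun s => by simpa [heven] using hwe (-s)) t
    have := hw.2 (-x) (-y) s h0 h1
    rwa [smul_neg, smul_neg, ← neg_add] at this
  refine ⟨g, hgt, ⟨convex_univ, fun x _ y _ α β hα hβ hαβ => ?_⟩,
    fun t => le_antisymm (hneg t) (by simpa using hneg (-t)), fun t => ?_, fun f hf hfe t => ?_⟩
  · rw [← EReal.coe_le_coe_iff, ← hgt]
    refine envelope_le fun w hw hwe => ?_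
    obtain ⟨w', rfl⟩ := exists_real_of_le_coe hw.1 hwe
    have hα' : α = 1 - β := by linarith
    subst hα'
    have h1 : w' ((1 - β) • x + β • y) ≤ (1 - β) * w' x + β * w' y :=
      coe_le_coe_mul_add_coe_mul_iff.mp (hw.2 x y β hβ (by linarith))
    have h2 := mul_le_mul_of_nonneg_left (EReal.coe_le_coe_iff.mp (hmax' _ hw hwe x)) hα
    have h3 := mul_le_mul_of_nonneg_left (EReal.coe_le_coe_iff.mp (hmax' _ hw hwe y)) hβ
    rw [EReal.coe_le_coe_iff]
    simp only [smul_eq_mul] at h1 ⊢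
    linarith
  · rw [← EReal.coe_le_coe_iff, ← hgt]; exact hle t
  · rw [← EReal.coe_le_coe_iff, ← hgt]; exact hmax f hf hfe t

/-! ### Comparison of the envelopes -/

lemma evenExtension_eq (h : ℝ → ℝ) (t : ℝ) : evenExtension h t = h |t| := by
  rw [evenExtension]
  split_ifs with ht
  · rw [abs_of_nonneg ht]
  · rw [abs_of_neg (not_le.mp ht)]

lemma mul_diagonal_update_mul {n : ℕ} (U V : Matrix (Fin n) (Fin n) ℝ) (x : Fin n → ℝ)
    (k : Fin n) (s : ℝ) :
    U * Matrix.diagonal (Function.update x k s) * V.transpose =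
      U * Matrix.diagonal (Function.update x k 0) * V.transpose +
        s • Matrix.vecMulVec (U.transpose k) (V.transpose k) := by
  ext i j
  rw [Matrix.add_apply, Matrix.mul_apply, Matrix.mul_apply,
    ← Finset.add_sum_erase _ _ (Finset.mem_univ k),
    ← Finset.add_sum_erase (a := k) _ _ (Finset.mem_univ k)]
  have h : ∑ m ∈ Finset.univ.erase k,
      (U * Matrix.diagonal (Function.update x k s)) i m * V.transpose m j =
      ∑ m ∈ Finset.univ.erase k,
      (U * Matrix.diagonal (Function.update x k 0)) i m * V.transpose m j := by
    refine Finset.sum_congr rfl fun m hm => ?_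
    have hmk := (Finset.mem_erase.mp hm).1
    rw [Matrix.mul_diagonal, Matrix.mul_diagonal, Function.update_of_ne hmk,
      Function.update_of_ne hmk]
  rw [h]
  simp only [Matrix.mul_diagonal, Function.update_self, Matrix.smul_apply, Matrix.vecMulVec_apply,
    Matrix.transpose_apply, smul_eq_mul]
  ring

/-- A function that is convex along the rank-one lines spanned by `a ⊗ b` and lies below
`∑ k, h (σ k)` also lies below the sum of the convex envelopes: `x ↦ w (U diag(x) Vᵀ)` is
separately convex, so `h` can be replaced by its envelope one coordinate at a time. -/
theorem le_sum_convex_of_le_sum_singularValue {n : ℕ} {h g : ℝ → ℝ}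
    {w : Matrix (Fin n) (Fin n) ℝ → ℝ}
    (hw : ∀ B ∈ Matrix.orthogonalGroup (Fin n) ℝ, ∀ (k : Fin n) (F : Matrix (Fin n) (Fin n) ℝ)
      (a : Fin n → ℝ), ConvexOn ℝ Set.univ fun s : ℝ => w (F + s • Matrix.vecMulVec a (B k)))
    (hle : ∀ F, w F ≤ ∑ k, h (singularValue F k))
    (hg : ∀ f : ℝ → ℝ, ConvexOn ℝ Set.univ f → (∀ t, f t ≤ evenExtension h t) → ∀ t, f t ≤ g t)
    (F : Matrix (Fin n) (Fin n) ℝ) : w F ≤ ∑ k, g (singularValue F k) := by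
  obtain ⟨U, hU, V, hV, hF⟩ := exists_singularValueDecomposition F
  have key : ∀ (S : Finset (Fin n)) (x : Fin n → ℝ),
      w (U * Matrix.diagonal x * V.transpose) ≤
        ∑ k ∈ S, g (x k) + ∑ k ∈ Sᶜ, evenExtension h (x k) := by
    intro S
    induction S using Finset.induction_on with
    | empty =>
      intro x
      refine (hle _).trans (le_of_eq ?_)
      rw [sum_singularValue_of_orthogonal hU hV x h]
      simp [evenExtension_eq]
    | insert k S hk ih =>
      intro x
      set r := ∑ i ∈ S, g (x i) + ∑ i ∈ (insert k S)ᶜ, evenExtension h (x i) with hr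
      have hconv : ConvexOn ℝ Set.univ fun s : ℝ =>
          w (U * Matrix.diagonal (Function.update x k s) * V.transpose) - r := by
        have h1 := (hw _ (transpose_mem_orthogonalGroup hV) k
          (U * Matrix.diagonal (Function.update x k 0) * V.transpose)
          (U.transpose k)).add_const (-r)
        have h2 : (fun s : ℝ => w (U * Matrix.diagonal (Function.update x k s) * V.transpose) - r) =
            fun s : ℝ => w (U * Matrix.diagonal (Function.update x k 0) * V.transpose +
              s • Matrix.vecMulVec (U.transpose k) (V.transpose k)) + -r :=
          funext fun s => by rw [mul_diagonal_update_mul U V x k s, sub_eq_add_neg]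
        rw [h2]
        exact h1
      have hbound : ∀ s : ℝ, w (U * Matrix.diagonal (Function.update x k s) * V.transpose) - r ≤
          evenExtension h s := by
        intro s
        have h1 := ih (Function.update x k s)
        have h2 : ∑ i ∈ S, g (Function.update x k s i) = ∑ i ∈ S, g (x i) :=
          Finset.sum_congr rfl fun i hi => by
            rw [Function.update_of_ne (ne_of_mem_of_not_mem hi hk)]
        have h3 : ∑ i ∈ Sᶜ, evenExtension h (Function.update x k s i) =
            evenExtension h s + ∑ i ∈ (insert k S)ᶜ, evenExtension h (x i) := by
          rw [← Finset.add_sum_erase _ _ (Finset.mem_compl.mpr hk), Function.update_self,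
            Finset.compl_insert]
          congr 1
          exact Finset.sum_congr rfl fun i hi => by
            rw [Function.update_of_ne (Finset.mem_erase.mp hi).1]
        rw [h2, h3] at h1
        linarith
      have h4 := hg _ hconv hbound (x k)
      rw [Function.update_eq_self] at h4
      rw [Finset.sum_insert hk]
      linarith
  have h5 := key Finset.univ (singularValue F)
  rw [← hF] at h5
  simpa using h5

/-- A sum of a convex even function over the singular values is quasiconvex: it has an affine
minorant touching it at `F`, and weak gradients of `W₀^{1,∞}` functions have mean value zero. -/
theorem isQuasiconvex_sum_singularValue {n : ℕ} {g : ℝ → ℝ} (hg : ConvexOn ℝ Set.univ g)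
    (heven : ∀ t, g (-t) = g t) :
    IsQuasiconvex fun X : Matrix (Fin n) (Fin n) ℝ =>
      ((∑ k, g (singularValue X k) : ℝ) : EReal) := by
  refine ⟨fun _ => EReal.coe_ne_bot _, fun Ω _ hb _ F ϑ G hϑ _ => ?_⟩
  obtain ⟨C, hC⟩ := exists_affine_le_sum_singularValue hg heven F
  have hfin : IsFiniteMeasure (volume.restrict Ω) := ⟨by simpa using hb.measure_lt_top⟩
  have hint : ∀ i j, Integrable (fun x => C i j * G x i j) (volume.restrict Ω) := fun i j =>
    (((hϑ i).1.2.1 j).integrable le_top).const_mul _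
  have hint' : Integrable (fun x => ∑ i, ∑ j, C i j * G x i j) (volume.restrict Ω) :=
    integrable_finsetSum _ fun i _ => integrable_finsetSum _ fun j _ => hint i j
  have hzero : ∫ x in Ω, ∑ i, ∑ j, C i j * G x i j = 0 := by
    rw [integral_finsetSum _ fun i _ => integrable_finsetSum _ fun j _ => hint i j]
    refine Finset.sum_eq_zero fun i _ => ?_
    rw [integral_finsetSum _ fun j _ => hint i j]
    refine Finset.sum_eq_zero fun j _ => ?_
    rw [integral_const_mul, (hϑ i).integral_eq_zero j, mul_zero]
  have h := extIntegral_mono (μ := volume.restrict Ω)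
    fun x => EReal.coe_le_coe_iff.mpr (hC (G x))
  rw [extIntegral_coe (f := fun x => ∑ k, g (singularValue F k) + ∑ i, ∑ j, C i j * G x i j)
      ((integrable_const _).add hint'),
    integral_add (integrable_const _) hint', hzero, add_zero, integral_const, smul_eq_mul] at h
  refine le_trans (le_of_eq ?_) h
  rw [EReal.coe_mul, measureReal_restrict_apply_univ, measureReal_def,
    EReal.coe_ennreal_toReal hb.measure_lt_top.ne]

/-- If a real function with property `P` lies below `f` and dominates at `x` every real minorant
with property `P`, then it gives the value of the envelope at `x`. -/
lemma envelope_eq_coe {V : Type*} {P : (V → EReal) → Prop} {f v : V → ℝ} {x : V}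
    (hbot : ∀ w, P w → ∀ y, w y ≠ ⊥) (hv : P fun y => (v y : EReal)) (hle : ∀ y, v y ≤ f y)
    (hmax : ∀ w : V → ℝ, P (fun y => (w y : EReal)) → (∀ y, w y ≤ f y) → w x ≤ v x) :
    envelope P (fun y => (f y : EReal)) x = (v x : EReal) := by
  refine le_antisymm (envelope_le fun w hP hw => ?_)
    (le_envelope (w := fun y => (v y : EReal)) hv (fun y => EReal.coe_le_coe_iff.mpr (hle y)) x)
  obtain ⟨w', rfl⟩ := exists_real_of_le_coe (hbot w hP) hw
  exact EReal.coe_le_coe_iff.mpr (hmax w' hP fun y => EReal.coe_le_coe_iff.mp (hw y))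

theorem mainTheorem2 (n : ℕ) (h : ℝ → ℝ)
    (hcont : ContinuousOn h (Set.Ici 0)) (hbdd : BddBelow (h '' Set.Ici 0))
    (W : Matrix (Fin n) (Fin n) ℝ → ℝ)
    (hW : ∀ F : Matrix (Fin n) (Fin n) ℝ, W F = ∑ k : Fin n, h (singularValue F k))
    (F : Matrix (Fin n) (Fin n) ℝ) :
    rankOneConvexEnvelope (fun X => (W X : EReal)) F =
        quasiconvexEnvelope (fun X => (W X : EReal)) F ∧
      quasiconvexEnvelope (fun X => (W X : EReal)) F =
        polyconvexEnvelope (fun X => (W X : EReal)) F ∧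
      polyconvexEnvelope (fun X => (W X : EReal)) F =
        convexEnvelope (fun X => (W X : EReal)) F ∧
      convexEnvelope (fun X => (W X : EReal)) F =
        ∑ k : Fin n, convexEnvelope (fun t : ℝ => (evenExtension h t : EReal))
          (singularValue F k) := by
  obtain ⟨m, hm⟩ := hbdd
  obtain ⟨g, hgenv, hg, heven, hgle, hgmax⟩ := exists_real_convexEnvelope (e := evenExtension h)
    (m := m) (fun t => by rw [evenExtension_eq]; exact hm ⟨|t|, abs_nonneg t, rfl⟩)
    (fun t => by simp only [evenExtension_eq, abs_neg])
  have hle : ∀ X, ∑ k, g (singularValue X k) ≤ W X := fun X => by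
    rw [hW]
    refine Finset.sum_le_sum fun k _ => (hgle _).trans (le_of_eq ?_)
    rw [evenExtension_eq, abs_of_nonneg (singularValue_nonneg X k)]
  have hconv : IsConvexFun fun X : Matrix (Fin n) (Fin n) ℝ =>
      ((∑ k, g (singularValue X k) : ℝ) : EReal) :=
    isConvexFun_coe fun X Y t h0 h1 => convex_sum_singularValue hg heven X Y h0 h1
  have hR : rankOneConvexEnvelope (fun X => (W X : EReal)) F =
      ((∑ k, g (singularValue F k) : ℝ) : EReal) :=
    envelope_eq_coe (fun w hw => hw.1) hconv.isRankOneConvex hle fun w hw hwW =>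
      le_sum_convex_of_le_sum_singularValue (fun B _ k X a => hw.convexOn_rankOne X a (B k))
        (fun X => (hwW X).trans (hW X).le) hgmax F
  have hQ : quasiconvexEnvelope (fun X => (W X : EReal)) F =
      ((∑ k, g (singularValue F k) : ℝ) : EReal) :=
    envelope_eq_coe (fun w hw => hw.1) (isQuasiconvex_sum_singularValue hg heven) hle
      fun w hw hwW => le_sum_convex_of_le_sum_singularValue
        (fun B hB k X a => hw.convexOn_rankOne hB k X a)
        (fun X => (hwW X).trans (hW X).le) hgmax F
  have hP : polyconvexEnvelope (fun X => (W X : EReal)) F =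
      ((∑ k, g (singularValue F k) : ℝ) : EReal) :=
    envelope_eq_coe (fun w hw => hw.ne_bot) hconv.isPolyconvex hle fun w hw hwW =>
      le_sum_convex_of_le_sum_singularValue (fun B _ k X a => hw.convexOn_rankOne X a (B k))
        (fun X => (hwW X).trans (hW X).le) hgmax F
  have hC : convexEnvelope (fun X => (W X : EReal)) F =
      ((∑ k, g (singularValue F k) : ℝ) : EReal) :=
    envelope_eq_coe (fun w hw => hw.1) hconv hle fun w hw hwW =>
      le_sum_convex_of_le_sum_singularValue
        (fun B _ k X a => hw.isRankOneConvex.convexOn_rankOne X a (B k))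
        (fun X => (hwW X).trans (hW X).le) hgmax F
  refine ⟨hR.trans hQ.symm, hQ.trans hP.symm, hP.trans hC.symm, ?_⟩
  rw [hC]
  simp only [hgenv]
  exact map_sum (⟨⟨fun r : ℝ => (r : EReal), EReal.coe_zero⟩, EReal.coe_add⟩ : ℝ →+ EReal) _ _
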